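/- Let $D\ge 2$. A closed $(D+1)$-colored graph $\mathcal G$ with $2p$ vertices consists of $p$ white vertices, $p$ black vertices and, for each color $i\in\{0,\dots,D\}$, a perfect matching between white and black vertices whose elements are the lines of color $i$, oriented from white to black (multiple lines are allowed). The faces of colors $\{i,j\}$ are the closed cycles alternating between lines of colors $i$ and $j$; the $D$-bubbles without the color $i$ are the connected components left after deleting all lines of color $i$ (they are $D$-colored graphs). A jacket of a connected graph with color set $C$ is given by a cyclic permutation $\tau$ of all elements of $C$, modulo $\tau\sim\tau^{-1}$; it is the ribbon graph with all vertices and lines of the graph and with the faces of colors $(c,\tau(c))$, $c\in C$, and its genus $g$ is given by $2-2g=\#\text{vertices}-\#\text{lines}+\#\text{faces}$. The degree $\omega$ of the graph is the sum of the genera of its jackets. A connected $(D+1)$-colored graph is a topological core graph if for every color $i$ either it has a unique $D$-bubble without the color $i$ and this bubble has degree $0$, or all its $D$-bubbles without the color $i$ have degree $\ge 1$. Let $G$ be a compact second countable Hausdorff group (for instance a compact Lie group) with unit $e$ and normalized Haar measure $dh$, and let $(\delta^N)_{N\in\mathbb N}$ be a family of regularized delta functions on $G$: each $\delta^N:G\to\mathbb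 R$ is a continuous class function with $\delta^N(g^{-1})=\delta^N(g)$ and $\int\delta^N\,dh=1$; $\int\delta^N\varphi\,dh\to\varphi(e)$ as $N\to\infty$ for every continuous $\varphi:G\to\mathbb R$; and each $\delta^N$ is either such that $0\le\delta^N(g)\le\delta^N(e)$ for all $g$ (for instance a heat kernel), or a sum $\sum_{\chi\in\Lambda_N}\chi$ over a finite set $\Lambda_N$ of continuous characters $\chi:G\to U(1)$ (a sharp cutoff on the Fourier modes of an abelian group). For $\lambda\in\mathbb C$ the Boulatov–Ooguri amplitude of a $(D+1)$-colored graph $\mathcal G$ with $2p$ vertices is $$A^{\mathrm{BO}}(\mathcal G)=\frac{(\lambda\bar\lambda)^p}{[\delta^N(e)]^{p\frac{(D-2)(D-1)}{2}}}\int\prod_{\ell}dh_\ell\prod_{f}\delta^N\Big(\overrightarrow{\prod_{\ell\in f}}h_\ell^{\sigma^{\ell|f}}\Big),$$ where $\ell$ runs over the lines and $f$ over the faces of $\mathcal G$, and $\sigma^{\ell|f}=\pm1$ according to whether the orientations of $\ell$ and $f$ agree or are opposite. Then for every topological core graph $\mathcal G$ with $2p$ vertices, every $\lambda\in\mathbb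 C$ and every $N$, $$A^{\mathrm{BO}}(\mathcal G)\le(\lambda\bar\lambda)^p\,[\delta^N(e)]^{\,D-1-\frac{2(D-2)}{D!}(p-1)}.$$ -/

import Mathlib

open MeasureTheory Filter Topology

universe u

/-- A (closed, bipartite) colored graph with colors `C`.  Its vertices are the positive (white) and
the negative (black) ones; for every color `c` every white vertex `w` is joined to the black vertex
`line c w` by exactly one line of color `c`, oriented from white to black, and every vertex is
touched by exactly one line of each color.  A `D + 1`-colored graph is a
`ColoredGraph (Fin (D + 1))`; multiple lines between two vertices are allowed. -/
structure ColoredGraph (C : Type u) where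
  White : Type
  Black : Type
  [finite_white : Finite White]
  [finite_black : Finite Black]
  line : C → White ≃ Black

namespace ColoredGraph

variable {C : Type u}

instance (G : ColoredGraph C) : Finite G.White := G.finite_white

instance (G : ColoredGraph C) : Finite G.Black := G.finite_black

noncomputable instance (G : ColoredGraph C) : Fintype G.White := Fintype.ofFinite _

noncomputable instance (G : ColoredGraph C) : Fintype G.Black := Fintype.ofFinite _

/-- The vertices of the graph. -/
abbrev Vertex (G : ColoredGraph C) : Type := G.White ⊕ G.Black

/-- The lines of the graph: `(c, w)` is the line of color `c` at the white vertex `w`. -/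
abbrev Line (G : ColoredGraph C) : Type u := C × G.White

/-- The number `p` of white vertices; the graph has `2 p` vertices. -/
noncomputable def order (G : ColoredGraph C) : ℕ := Fintype.card G.White

theorem card_vertex [Nonempty C] (G : ColoredGraph C) :
    Fintype.card G.Vertex = 2 * G.order := by
  have h := Fintype.card_congr (G.line (Classical.arbitrary C))
  rw [Fintype.card_sum, order, ← h]
  ring

/-! ### Connectedness and bubbles -/

/-- The simple graph on the vertices in which two vertices are adjacent when a line joins them. -/
def toSimpleGraph (G : ColoredGraph C) : SimpleGraph G.Vertex :=
  SimpleGraph.fromRel fun x y => ∃ c w, x = Sum.inl w ∧ y = Sum.inr (G.line c w)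

/-- Connected (in particular non-empty) colored graphs. -/
def IsConnected (G : ColoredGraph C) : Prop := G.toSimpleGraph.Connected

theorem reachable_line (G : ColoredGraph C) (c : C) (w : G.White) :
    G.toSimpleGraph.connectedComponentMk (Sum.inr (G.line c w)) =
      G.toSimpleGraph.connectedComponentMk (Sum.inl w) := by
  refine SimpleGraph.ConnectedComponent.eq.2 (SimpleGraph.Adj.reachable ?_)
  rw [toSimpleGraph, SimpleGraph.fromRel_adj]
  exact ⟨by simp, Or.inr ⟨c, w, rfl, rfl⟩⟩

/-- A connected component of a colored graph, as a colored graph with the same colors. -/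
def component (G : ColoredGraph C) (q : G.toSimpleGraph.ConnectedComponent) : ColoredGraph C where
  White := {w : G.White // G.toSimpleGraph.connectedComponentMk (Sum.inl w) = q}
  Black := {b : G.Black // G.toSimpleGraph.connectedComponentMk (Sum.inr b) = q}
  line c := (G.line c).subtypeEquiv fun w => by rw [G.reachable_line c w]

/-- The graph obtained by deleting all lines of color `i`. -/
def deleteColor (G : ColoredGraph C) (i : C) : ColoredGraph {c : C // c ≠ i} where
  White := G.White
  Black := G.Black
  line c := G.line c.1

/-- Labels of the bubbles with colors `C \ {i}` (for `C = {0, …, D}` these are the `D`-bubbles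
without the color `i`): the connected components left after deleting the lines of color `i`. -/
abbrev BubbleIndex (G : ColoredGraph C) (i : C) : Type :=
  (G.deleteColor i).toSimpleGraph.ConnectedComponent

/-- The bubble with colors `C \ {i}` and label `q`, as a colored graph with one color less. -/
abbrev bubble (G : ColoredGraph C) (i : C) (q : G.BubbleIndex i) : ColoredGraph {c : C // c ≠ i} :=
  (G.deleteColor i).component q

/-! ### Faces -/

/-- One step along a strand of colors `i, j`: from the white vertex `w` follow the line of color
`i`, and then go back along the line of color `j`, to the next white vertex. -/
def strandStep (G : ColoredGraph C) (i j : C) : Equiv.Perm G.White :=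
  (G.line i).trans (G.line j).symm

/-- The faces of colors `i, j`, that is, the closed strands that alternate between lines of color
`i` and of color `j`. A face is recorded by the cycle of white vertices that it visits. -/
def Face (G : ColoredGraph C) (i j : C) : Type :=
  Quotient (Equiv.Perm.SameCycle.setoid (G.strandStep i j))

instance (G : ColoredGraph C) (i j : C) : Finite (G.Face i j) := by
  unfold Face; infer_instance

noncomputable instance (G : ColoredGraph C) (i j : C) : Fintype (G.Face i j) := Fintype.ofFinite _

theorem strandStep_symm (G : ColoredGraph C) (i j : C) :
    G.strandStep j i = (G.strandStep i j)⁻¹ := rfl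

theorem card_face_comm (G : ColoredGraph C) (i j : C) :
    Fintype.card (G.Face i j) = Fintype.card (G.Face j i) := by
  refine Fintype.card_congr (Quotient.congr (Equiv.refl _) fun a b => ?_)
  change (G.strandStep i j).SameCycle a b ↔ (G.strandStep j i).SameCycle a b
  rw [strandStep_symm, Equiv.Perm.sameCycle_inv]

/-! ### Jackets and the degree -/

/-- The cyclic permutations of all the colors. -/
def ColorCycle (C : Type u) : Type u := {τ : Equiv.Perm C // τ.IsCycleOn Set.univ}

/-- Two color cycles are identified when they differ by the orientation. -/
def ColorCycle.setoid (C : Type u) : Setoid (ColorCycle C) where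
  r σ τ := σ.1 = τ.1 ∨ σ.1 = τ.1⁻¹
  iseqv :=
    { refl := fun _ => Or.inl rfl
      symm := by
        rintro σ τ (h | h)
        · exact Or.inl h.symm
        · exact Or.inr (by rw [h, inv_inv])
      trans := by
        rintro ρ σ τ (h | h) (h' | h') <;> simp [h, h'] }

/-- The jackets of a graph with colors `C`: cycles of all the colors modulo orientation. -/
def Jacket (C : Type u) : Type u := Quotient (ColorCycle.setoid C)

instance (C : Type u) [Finite C] : Finite (Jacket C) := by
  have : Finite (ColorCycle C) := by unfold ColorCycle; infer_instance
  exact Quotient.finite _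

noncomputable instance (C : Type u) [Finite C] : Fintype (Jacket C) := Fintype.ofFinite _

/-- The number of faces of the jacket of the cycle `τ`, i.e. of the faces of `G` whose colors
are `(c, τ c)` for some `c`. -/
noncomputable def cycleFaceCount [Fintype C] (G : ColoredGraph C) (τ : Equiv.Perm C) : ℕ :=
  ∑ c : C, Fintype.card (G.Face c (τ c))

theorem cycleFaceCount_inv [Fintype C] (G : ColoredGraph C) (τ : Equiv.Perm C) :
    G.cycleFaceCount τ⁻¹ = G.cycleFaceCount τ := by
  unfold cycleFaceCount
  rw [← Equiv.sum_comp τ]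
  refine Finset.sum_congr rfl fun c _ => ?_
  rw [Equiv.Perm.inv_def, Equiv.symm_apply_apply, card_face_comm]

/-- The number of faces of the jacket `J` of `G`. -/
noncomputable def jacketFaceCount [Fintype C] (G : ColoredGraph C) (J : Jacket C) : ℕ :=
  Quotient.lift (fun τ : ColorCycle C => G.cycleFaceCount τ.1) (by
    rintro σ τ (h | h)
    · exact congrArg G.cycleFaceCount h
    · exact (congrArg G.cycleFaceCount h).trans (G.cycleFaceCount_inv τ.1)) J

/-- The genus of the jacket `J` of a connected graph `G`: the jacket is the ribbon graph with the
vertices and the lines of `G` and with the faces counted above, so that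
`2 - 2 g = #vertices - #lines + #faces`. -/
noncomputable def jacketGenus [Fintype C] (G : ColoredGraph C) (J : Jacket C) : ℚ :=
  (2 - ((Fintype.card G.Vertex : ℚ) - (Fintype.card G.Line : ℚ) + (G.jacketFaceCount J : ℚ))) / 2

/-- The degree of a connected graph: the sum of the genera of its jackets. -/
noncomputable def degree [Fintype C] (G : ColoredGraph C) : ℚ := ∑ J : Jacket C, G.jacketGenus J

/-- Topological core graphs: for each color `i`, either there is a unique bubble without the
color `i` and it has degree `0`, or all the bubbles without the color `i` have degree at least
`1`. -/
def IsTopologicalCore [Fintype C] [DecidableEq C] (G : ColoredGraph C) : Prop :=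
  G.IsConnected ∧ ∀ i : C,
    (∃ q : G.BubbleIndex i, (∀ q' : G.BubbleIndex i, q' = q) ∧ (G.bubble i q).degree = 0) ∨
      ∀ q : G.BubbleIndex i, 1 ≤ (G.bubble i q).degree

/-! ### Holonomies and the amplitude -/

section Holonomy

variable {Γ : Type*} [Group Γ]

/-- The ordered product of the group elements along the closed strand of colors `i, j` that starts
at the white vertex `w`: lines of color `i` are followed along their orientation and
lines of color `j` against it. -/
noncomputable def holonomy (G : ColoredGraph C) (h : G.Line → Γ) (i j : C) (w : G.White) : Γ :=
  ((List.range (Function.minimalPeriod (G.strandStep i j) w)).map fun k =>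
    h (i, (G.strandStep i j)^[k] w) * (h (j, (G.strandStep i j)^[k + 1] w))⁻¹).prod

/-- The weight of a face: a function `δ` evaluated at the holonomy of the face, starting at one of
the white vertices of the face. -/
noncomputable def faceWeight (G : ColoredGraph C) (δ : Γ → ℝ) (h : G.Line → Γ) (i j : C)
    (f : G.Face i j) : ℝ :=
  δ (G.holonomy h i j (Quotient.out f))

end Holonomy

/-- The Boulatov–Ooguri amplitude of a `D + 1`-colored graph for the coupling constant `lam`, the
normalized Haar measure `μ` and the regularized delta function `δ`. -/
noncomputable def amplitudeBO {Γ : Type*} [Group Γ] [MeasurableSpace Γ] (μ : Measure Γ)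
    (δ : Γ → ℝ) (lam : ℂ) {D : ℕ} (G : ColoredGraph (Fin (D + 1))) : ℝ :=
  Complex.normSq lam ^ G.order / δ 1 ^ ((G.order : ℝ) * (((D : ℝ) - 2) * ((D : ℝ) - 1) / 2)) *
    ∫ h : G.Line → Γ,
      ∏ i : Fin (D + 1), ∏ j ∈ Finset.Ioi i, ∏ f : G.Face i j, G.faceWeight δ h i j f
      ∂(Measure.pi fun _ => μ)

end ColoredGraph

/-- A family `δ N` of regularized delta functions on a compact group: normalized symmetric
continuous class functions that converge weakly to the Dirac mass at the unit. Each `δ N` is either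
nonnegative with its largest value at the unit (heat kernels, Fejér type kernels), or, for an
abelian group, given by a sharp cutoff on the Fourier modes, the sum of finitely many
characters. -/
structure IsRegularizedDelta {Γ : Type*} [Group Γ] [TopologicalSpace Γ] [MeasurableSpace Γ]
    (μ : Measure Γ) (δ : ℕ → Γ → ℝ) : Prop where
  continuous : ∀ N, Continuous (δ N)
  conj : ∀ N g k, δ N (k * g * k⁻¹) = δ N g
  inv : ∀ N g, δ N g⁻¹ = δ N g
  integral_eq_one : ∀ N, ∫ g, δ N g ∂μ = 1
  tendsto : ∀ φ : C(Γ, ℝ), Tendsto (fun N => ∫ g, δ N g * φ g ∂μ) atTop (𝓝 (φ 1))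
  cutoff : ∀ N, (∀ g, 0 ≤ δ N g ∧ δ N g ≤ δ N 1) ∨
    ∃ Λ : Finset (Γ →ₜ* Circle), ∀ g, (δ N g : ℂ) = ∑ χ ∈ Λ, (χ g : ℂ)

namespace ColoredGraph

variable {C : Type u} {Γ : Type*} [Group Γ]

theorem holonomy_strandStep (G : ColoredGraph C) (h : G.Line → Γ) (i j : C) (w : G.White) :
    ∃ k : Γ, G.holonomy h i j w = k * G.holonomy h i j (G.strandStep i j w) * k⁻¹ := by
  set φ := G.strandStep i j with hφ
  have hper : w ∈ Function.periodicPts φ := by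
    refine ⟨orderOf φ, orderOf_pos φ, ?_⟩
    rw [Function.IsPeriodicPt, Function.IsFixedPt, Equiv.Perm.iterate_eq_pow, pow_orderOf_eq_one]
    rfl
  have hn : Function.minimalPeriod φ (φ w) = Function.minimalPeriod φ w :=
    Function.minimalPeriod_apply hper
  have hpos : 0 < Function.minimalPeriod φ w := Function.minimalPeriod_pos_of_mem_periodicPts hper
  obtain ⟨m, hm⟩ : ∃ m, Function.minimalPeriod φ w = m + 1 := ⟨_, (Nat.sub_add_cancel hpos).symm⟩
  refine ⟨h (i, w) * (h (j, φ w))⁻¹, ?_⟩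
  have hit : φ^[m + 1] w = w := hm ▸ Function.iterate_minimalPeriod
  unfold holonomy
  rw [← hφ, hn, hm, List.prod_range_succ', List.prod_range_succ]
  simp only [← Function.iterate_succ_apply, Function.iterate_zero, id, Nat.succ_eq_add_one, zero_add]
  have hlast : φ^[m + 1 + 1] w = φ w := by rw [Function.iterate_succ_apply', hit]
  rw [hit, hlast, Function.iterate_one]
  simp [mul_assoc]

/-- For a class function the weight of a face does not depend on the starting point. -/
theorem faceWeight_mk (G : ColoredGraph C) (δ : Γ → ℝ) (hδ : ∀ g k, δ (k * g * k⁻¹) = δ g)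
    (h : G.Line → Γ) (i j : C) (w : G.White) :
    G.faceWeight δ h i j (Quotient.mk (Equiv.Perm.SameCycle.setoid (G.strandStep i j)) w) =
      δ (G.holonomy h i j w) := by
  have key : ∀ n : ℕ, ∀ v : G.White,
      δ (G.holonomy h i j (((G.strandStep i j) ^ n) v)) = δ (G.holonomy h i j v) := by
    intro n
    induction n with
    | zero => intro v; rfl
    | succ n ih =>
      intro v
      rw [pow_succ, Equiv.Perm.mul_apply, ih]
      obtain ⟨k, hk⟩ := G.holonomy_strandStep h i j v
      rw [hk, hδ]
  have hs : (G.strandStep i j).SameCycle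
      (Quotient.out (Quotient.mk (Equiv.Perm.SameCycle.setoid (G.strandStep i j)) w)) w :=
    Quotient.exact (s := Equiv.Perm.SameCycle.setoid (G.strandStep i j))
      (Quotient.out_eq (Quotient.mk (Equiv.Perm.SameCycle.setoid (G.strandStep i j)) w))
  obtain ⟨n, hn⟩ := hs.exists_nat_pow_eq
  unfold faceWeight
  conv_rhs => rw [← hn]
  exact (key n _).symm

end ColoredGraph

/-! ### Color cycles -/

/-! Write `F` for the number of faces and `F_J` for those of a jacket `J`. The proof bounds the
integral by a power of `δ(e)` depending on one jacket, and then counts faces.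

Integral: the faces of a jacket tile a connected surface, and each line borders at most two of them.
Hence every nonempty proper subset of them contains a face with a line that no other face of the
subset uses (`exists_private_line`). Integrating over such lines one at a time removes all jacket
faces but one, each with factor `1`. If `0 ≤ δ ≤ δ(e)`, bounding the other factors by `δ(e)` gives
`δ(e)^(F - F_J + 1)` (`integral_le_of_nonneg`). For a sum of characters there is no positivity. The
integral then counts the labellings of faces by characters whose product is trivial, and private
lines show that such a labelling is determined off the jacket and on one face of it
(`integral_le_of_characters`).

Counting: averaging over color cycles yields a jacket with `F_J ≥ 2F/D`, so `F - F_J ≤ (D-2)F/D`.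
The same averaging expresses degrees by face numbers (`degree_eq`); summed over all `B` bubbles,
with `a = (D-1)!/2`, it gives `F = B + (D+1)(D-2)p/2 - (sum of bubble degrees)/a`. The core
condition makes that sum at least `B - (D+1)`. For `D ≥ 3` one has `a ≥ 1`, so the resulting bound
increases with `B`, and `B ≤ p + D` (`sum_card_bubbleIndex_le`) finishes the count. For `D = 2` the
average jacket already contains all faces. -/

namespace ColoredGraph

section ColorCycles

variable {C : Type u} [Fintype C]

open Classical in
/-- The cyclic permutations of all the colors, as a finite set. -/
noncomputable def colorCycles (C : Type u) [Fintype C] : Finset (Equiv.Perm C) :=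
  Finset.univ.filter fun τ => τ.IsCycleOn Set.univ

theorem mem_colorCycles {τ : Equiv.Perm C} : τ ∈ colorCycles C ↔ τ.IsCycleOn Set.univ := by
  simp [colorCycles]

theorem conj_mem_colorCycles {τ : Equiv.Perm C} (h : τ ∈ colorCycles C) (g : Equiv.Perm C) :
    g * τ * g⁻¹ ∈ colorCycles C := by
  rw [mem_colorCycles] at h ⊢
  simpa using h.conj (g := g)

theorem colorCycle_apply_ne {τ : Equiv.Perm C} (h : τ ∈ colorCycles C)
    (hC : 2 ≤ Fintype.card C) (c : C) : τ c ≠ c := by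
  have : Nontrivial C := Fintype.one_lt_card_iff_nontrivial.1 hC
  exact (mem_colorCycles.1 h).apply_ne Set.nontrivial_univ (Set.mem_univ c)

theorem colorCycle_apply_apply_ne {τ : Equiv.Perm C} (h : τ ∈ colorCycles C)
    (hC : 3 ≤ Fintype.card C) (c : C) : τ (τ c) ≠ c := by
  intro hc
  have h1 : τ.IsCycleOn ((Finset.univ : Finset C) : Set C) := by
    simpa using mem_colorCycles.1 h
  have h2 := (h1.pow_apply_eq (Finset.mem_univ c) (n := 2)).1 (by simpa [pow_two] using hc)
  have h3 := Nat.le_of_dvd two_pos h2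
  rw [Finset.card_univ] at h3
  omega

-- Color permutations act transitively on ordered pairs of distinct colors, and conjugation
-- preserves full cycles.
open Classical in
theorem card_colorCycles_apply_eq {c d c' d' : C} (h : c ≠ d) (h' : c' ≠ d') :
    ((colorCycles C).filter fun τ => τ c = d).card =
      ((colorCycles C).filter fun τ => τ c' = d').card := by
  have hne : c' ≠ Equiv.swap c c' d := by
    intro e
    have := congrArg (Equiv.swap c c') e
    rw [Equiv.swap_apply_self, Equiv.swap_apply_right] at this
    exact h this
  obtain ⟨g, hc, hd⟩ : ∃ g : Equiv.Perm C, g c = c' ∧ g d = d' := by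
    refine ⟨Equiv.swap (Equiv.swap c c' d) d' * Equiv.swap c c', ?_, by simp⟩
    rw [Equiv.Perm.mul_apply, Equiv.swap_apply_left, Equiv.swap_apply_of_ne_of_ne hne h']
  refine Finset.card_bij' (fun τ _ => g * τ * g⁻¹) (fun τ _ => g⁻¹ * τ * g) ?_ ?_ ?_ ?_
  · intro τ hτ
    rw [Finset.mem_filter] at hτ ⊢
    refine ⟨conj_mem_colorCycles hτ.1 g, ?_⟩
    rw [Equiv.Perm.mul_apply, Equiv.Perm.mul_apply, ← hc, Equiv.Perm.inv_def, Equiv.symm_apply_apply, hτ.2, hd]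
  · intro τ hτ
    rw [Finset.mem_filter] at hτ ⊢
    refine ⟨by simpa using conj_mem_colorCycles hτ.1 g⁻¹, ?_⟩
    simp [hc, hτ.2, ← hd]
  · intro τ _; group
  · intro τ _; group

open Classical in
theorem card_colorCycles_apply_eq_mul (hC : 2 ≤ Fintype.card C) {c d : C} (h : c ≠ d) :
    ((colorCycles C).filter fun τ => τ c = d).card * (Fintype.card C - 1) =
      (colorCycles C).card := by
  have h1 : (colorCycles C).card = ∑ e ∈ Finset.univ.erase c,
      ((colorCycles C).filter fun τ => τ c = e).card :=
    Finset.card_eq_sum_card_fiberwise fun τ hτ => by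
      simpa using colorCycle_apply_ne hτ hC c
  rw [h1, Finset.sum_congr rfl fun e he =>
    card_colorCycles_apply_eq (C := C) (c := c) (d := e) (Finset.ne_of_mem_erase he).symm h]
  simp [Finset.card_erase_of_mem, mul_comm]

-- Double counting: each ordered pair of distinct colors is a step of the same number of cycles, a
-- fraction `1 / (n - 1)` of them for `n` colors.
open Classical in
theorem sum_colorCycles (hC : 2 ≤ Fintype.card C) (f : C → C → ℚ) :
    ((Fintype.card C : ℚ) - 1) * ∑ τ ∈ colorCycles C, ∑ c, f c (τ c) =
      (colorCycles C).card * ∑ c, ∑ d ∈ Finset.univ.erase c, f c d := by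
  rw [Finset.sum_comm, Finset.mul_sum, Finset.mul_sum]
  refine Finset.sum_congr rfl fun c _ => ?_
  rw [← Finset.sum_fiberwise_of_maps_to (s := colorCycles C) (t := Finset.univ.erase c)
    (g := fun τ => τ c) (fun τ hτ => by simpa using colorCycle_apply_ne hτ hC c),
    Finset.mul_sum, Finset.mul_sum]
  refine Finset.sum_congr rfl fun d hd => ?_
  rw [Finset.sum_congr rfl (g := fun _ => f c d) fun τ hτ => by rw [(Finset.mem_filter.1 hτ).2],
    Finset.sum_const, ← card_colorCycles_apply_eq_mul hC (Finset.ne_of_mem_erase hd).symm,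
    nsmul_eq_mul, Nat.cast_mul, Nat.cast_sub (by omega)]
  push_cast
  ring

theorem card_colorCycles (hC : 2 ≤ Fintype.card C) :
    (colorCycles C).card = (Fintype.card C - 1).factorial := by
  classical
  have : Nontrivial C := Fintype.one_lt_card_iff_nontrivial.1 hC
  have h := Equiv.Perm.card_of_cycleType_singleton (α := C) hC le_rfl
  rw [Nat.choose_self, mul_one] at h
  rw [← h]
  congr 1
  ext τ
  rw [mem_colorCycles, Finset.mem_filter]
  constructor
  · intro hτ
    have hs : τ.support = Finset.univ := by
      ext c
      simpa using hτ.apply_ne Set.nontrivial_univ (Set.mem_univ c)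
    have hcyc : τ.IsCycle := by
      obtain ⟨c⟩ : Nonempty C := inferInstance
      exact ⟨c, hτ.apply_ne Set.nontrivial_univ (Set.mem_univ c),
        fun d _ => hτ.2 (Set.mem_univ c) (Set.mem_univ d)⟩
    refine ⟨Finset.mem_univ _, ?_⟩
    rw [hcyc.cycleType, hs, Finset.card_univ]
  · rintro ⟨-, hτ⟩
    have hcyc : τ.IsCycle := by
      rw [← Equiv.Perm.card_cycleType_eq_one, hτ, Multiset.card_singleton]
    have hs : τ.support = Finset.univ := by
      rw [← Finset.card_eq_iff_eq_univ, ← Equiv.Perm.sum_cycleType, hτ, Multiset.sum_singleton]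
    convert hcyc.isCycleOn
    ext c
    have : c ∈ τ.support := by rw [hs]; exact Finset.mem_univ c
    simpa using this

/-- The jacket of a color cycle. -/
def cycleJacket (τ : {τ // τ ∈ colorCycles C}) : Jacket C :=
  Quotient.mk (ColorCycle.setoid C) (⟨τ.1, mem_colorCycles.1 τ.2⟩ : ColorCycle C)

theorem cycleJacket_eq_iff (σ τ : {τ // τ ∈ colorCycles C}) :
    cycleJacket σ = cycleJacket τ ↔ σ.1 = τ.1 ∨ σ.1 = τ.1⁻¹ :=
  Quotient.eq (r := ColorCycle.setoid C)

theorem jacketFaceCount_cycleJacket (G : ColoredGraph C) (τ : {τ // τ ∈ colorCycles C}) :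
    G.jacketFaceCount (cycleJacket τ) = G.cycleFaceCount τ.1 := rfl

/-- The class of a cycle is `{τ, τ⁻¹}`. With at least three colors `τ` is not an involution, so each
class has exactly two elements. -/
theorem sum_jacket (hC : 3 ≤ Fintype.card C) (g : Jacket C → ℚ) :
    2 * ∑ J, g J = ∑ τ : {τ // τ ∈ colorCycles C}, g (cycleJacket τ) := by
  classical
  rw [← Finset.sum_fiberwise_of_maps_to (s := Finset.univ) (t := Finset.univ)
    (g := cycleJacket) (fun _ _ => Finset.mem_univ _), Finset.mul_sum]
  refine Finset.sum_congr rfl fun J _ => ?_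
  rw [Finset.sum_congr rfl (g := fun _ => g J) fun τ hτ => by rw [(Finset.mem_filter.1 hτ).2],
    Finset.sum_const, nsmul_eq_mul]
  congr 1
  obtain ⟨τ, rfl⟩ : ∃ τ, cycleJacket τ = J := by
    obtain ⟨τ, rfl⟩ := Quotient.exists_rep J
    exact ⟨⟨τ.1, mem_colorCycles.2 τ.2⟩, rfl⟩
  have hi : τ.1⁻¹ ∈ colorCycles C :=
    mem_colorCycles.2 (Equiv.Perm.isCycleOn_inv.2 (mem_colorCycles.1 τ.2))
  have hne : τ ≠ ⟨τ.1⁻¹, hi⟩ := by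
    intro e
    have e' : τ.1 = τ.1⁻¹ := congrArg Subtype.val e
    obtain ⟨c⟩ : Nonempty C := Fintype.card_pos_iff.1 (by omega)
    refine colorCycle_apply_apply_ne τ.2 hC c ?_
    rw [eq_inv_iff_mul_eq_one] at e'
    exact Equiv.congr_fun e' c
  have : (Finset.univ.filter fun σ => cycleJacket σ = cycleJacket τ) = {τ, ⟨τ.1⁻¹, hi⟩} := by
    ext σ
    rw [Finset.mem_filter, cycleJacket_eq_iff, Finset.mem_insert, Finset.mem_singleton,
      Subtype.ext_iff, Subtype.ext_iff]
    exact and_iff_right (Finset.mem_univ _)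
  rw [this, Finset.card_pair hne]
  rfl

open Classical in
/-- Summing the Euler characteristics of the jackets expresses the degree of a graph with at least
three colors by its number of vertices and of faces. -/
theorem degree_eq (hC : 3 ≤ Fintype.card C) (G : ColoredGraph C) :
    G.degree = ((Fintype.card C - 1).factorial : ℚ) / 2 *
      (1 + ((Fintype.card C : ℚ) - 2) / 2 * G.order -
        (∑ c, ∑ d ∈ Finset.univ.erase c, (Fintype.card (G.Face c d) : ℚ)) /
          (2 * ((Fintype.card C : ℚ) - 1))) := by
  have h1 := sum_jacket hC G.jacketGenus
  have : Nonempty C := Fintype.card_pos_iff.1 (by omega)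
  have hn : (3 : ℚ) ≤ Fintype.card C := by exact_mod_cast hC
  have hv : (Fintype.card G.Vertex : ℚ) = 2 * G.order := by exact_mod_cast G.card_vertex
  have hl : (Fintype.card G.Line : ℚ) = Fintype.card C * G.order := by
    rw [Fintype.card_prod, Nat.cast_mul, order]
  -- With `2p` vertices and `np` lines, the genus of a jacket is `1 + (n - 2)p/2` minus half its
  -- number of faces.
  have h2 : ∀ τ : {τ // τ ∈ colorCycles C},
      G.jacketGenus (cycleJacket τ) =
        (fun τ : Equiv.Perm C => 1 + ((Fintype.card C : ℚ) - 2) / 2 * G.order -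
          (∑ c, (Fintype.card (G.Face c (τ c)) : ℚ)) / 2) τ.1 := by
    intro τ
    have : (G.jacketFaceCount (cycleJacket τ) : ℚ) =
        ∑ c, (Fintype.card (G.Face c (τ.1 c)) : ℚ) := by
      simp [jacketFaceCount_cycleJacket, cycleFaceCount]
    rw [jacketGenus, this, hv, hl]
    ring
  rw [Finset.sum_congr rfl fun τ _ => h2 τ, Finset.sum_coe_sort (colorCycles C)
    (fun τ : Equiv.Perm C => 1 + ((Fintype.card C : ℚ) - 2) / 2 * G.order -
      (∑ c, (Fintype.card (G.Face c (τ c)) : ℚ)) / 2),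
    Finset.sum_sub_distrib, Finset.sum_const, ← Finset.sum_div, nsmul_eq_mul] at h1
  have h3 := sum_colorCycles (by omega) fun c d => (Fintype.card (G.Face c d) : ℚ)
  rw [card_colorCycles (by omega)] at h1 h3
  have h4 : (Fintype.card C : ℚ) - 1 ≠ 0 := by linarith
  rw [mul_comm, ← eq_div_iff h4] at h3
  rw [h3] at h1
  rw [degree, ← mul_right_inj' (two_ne_zero (α := ℚ)), h1]
  field_simp

open Classical in
/-- Some jacket has at least the average number of faces. -/
theorem exists_colorCycle (hC : 2 ≤ Fintype.card C) (G : ColoredGraph C) :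
    ∃ τ ∈ colorCycles C, (∑ c, ∑ d ∈ Finset.univ.erase c, (Fintype.card (G.Face c d) : ℚ)) ≤
      ((Fintype.card C : ℚ) - 1) * G.cycleFaceCount τ := by
  by_contra! hcon
  have h := sum_colorCycles hC fun c d => (Fintype.card (G.Face c d) : ℚ)
  have hne : (colorCycles C).Nonempty := by
    rw [← Finset.card_pos, card_colorCycles hC]
    exact Nat.factorial_pos _
  have := Finset.sum_lt_sum_of_nonempty hne hcon
  rw [Finset.sum_const, nsmul_eq_mul, ← h, ← Finset.mul_sum] at this
  simp [cycleFaceCount] at this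

end ColorCycles

end ColoredGraph

/-! ### Bubbles -/

namespace ColoredGraph

section Bubbles

variable {C : Type u}

/-- A function on the vertices which does not change along lines is constant on components. -/
theorem eq_of_reachable {X : Type*} (G : ColoredGraph C) (f : G.Vertex → X)
    (hf : ∀ c w, f (Sum.inr (G.line c w)) = f (Sum.inl w)) {x y : G.Vertex}
    (h : G.toSimpleGraph.Reachable x y) : f x = f y := by
  rw [SimpleGraph.reachable_iff_reflTransGen] at h
  induction h with
  | refl => rfl
  | tail _ hadj ih =>
    rw [ih]
    rw [toSimpleGraph, SimpleGraph.fromRel_adj] at hadj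
    obtain ⟨-, ⟨c, w, rfl, rfl⟩ | ⟨c, w, rfl, rfl⟩⟩ := hadj
    · exact (hf c w).symm
    · exact hf c w

noncomputable instance (G : ColoredGraph C) : Fintype G.toSimpleGraph.ConnectedComponent :=
  Fintype.ofFinite _

theorem sum_order_component (G : ColoredGraph C) :
    ∑ q, (G.component q).order = G.order := by
  unfold order
  rw [← Fintype.card_sigma]
  exact Fintype.card_congr
    (Equiv.sigmaFiberEquiv fun w => G.toSimpleGraph.connectedComponentMk (Sum.inl w))

theorem component_strandStep_pow (G : ColoredGraph C) (q : G.toSimpleGraph.ConnectedComponent)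
    (i j : C) (n : ℕ) (w : (G.component q).White) :
    (((G.component q).strandStep i j ^ n) w).1 = (G.strandStep i j ^ n) w.1 := by
  induction n with
  | zero => rfl
  | succ n ih =>
    rw [pow_succ', pow_succ', Equiv.Perm.mul_apply, Equiv.Perm.mul_apply, ← ih]
    rfl

theorem component_sameCycle (G : ColoredGraph C) (q : G.toSimpleGraph.ConnectedComponent)
    (i j : C) (v w : (G.component q).White) :
    ((G.component q).strandStep i j).SameCycle v w ↔ (G.strandStep i j).SameCycle v.1 w.1 := by
  constructor
  · intro h
    obtain ⟨n, hn⟩ := h.exists_nat_pow_eq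
    exact ⟨n, by rw [zpow_natCast, ← component_strandStep_pow, hn]⟩
  · intro h
    obtain ⟨n, hn⟩ := h.exists_nat_pow_eq
    exact ⟨n, by rw [zpow_natCast]; exact Subtype.ext ((G.component_strandStep_pow q i j n v).trans hn)⟩

theorem connectedComponentMk_strandStep (G : ColoredGraph C) (i j : C) (w : G.White) :
    G.toSimpleGraph.connectedComponentMk (Sum.inl (G.strandStep i j w)) =
      G.toSimpleGraph.connectedComponentMk (Sum.inl w) := by
  rw [← G.reachable_line j, ← G.reachable_line i w]
  simp [strandStep]

theorem connectedComponentMk_eq_of_sameCycle (G : ColoredGraph C) {i j : C} {v w : G.White}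
    (h : (G.strandStep i j).SameCycle v w) :
    G.toSimpleGraph.connectedComponentMk (Sum.inl v) =
      G.toSimpleGraph.connectedComponentMk (Sum.inl w) := by
  obtain ⟨n, rfl⟩ := h.exists_nat_pow_eq
  induction n with
  | zero => rfl
  | succ n ih =>
    rw [pow_succ', Equiv.Perm.mul_apply, connectedComponentMk_strandStep]
    exact ih ⟨n, by simp⟩

/-- A strand never leaves its component, so the faces of the graph are partitioned among the
components. -/
theorem sum_card_face_component (G : ColoredGraph C) (i j : C) :
    ∑ q, Fintype.card ((G.component q).Face i j) = Fintype.card (G.Face i j) := by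
  rw [← Fintype.card_sigma]
  let F : (Σ q, (G.component q).Face i j) → G.Face i j := fun x =>
    Quotient.map' (s₁ := Equiv.Perm.SameCycle.setoid ((G.component x.1).strandStep i j))
      (s₂ := Equiv.Perm.SameCycle.setoid (G.strandStep i j)) (fun w => w.1)
      (fun v w h => (G.component_sameCycle x.1 i j v w).1 h) x.2
  refine Fintype.card_of_bijective (f := F) ⟨?_, ?_⟩
  · rintro ⟨q, x⟩ ⟨r, y⟩ h
    obtain ⟨v, rfl⟩ := Quotient.exists_rep x
    obtain ⟨w, rfl⟩ := Quotient.exists_rep y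
    have h' : (G.strandStep i j).SameCycle v.1 w.1 :=
      Quotient.exact (s := Equiv.Perm.SameCycle.setoid (G.strandStep i j)) h
    have hqr : q = r := by
      rw [← v.2, ← w.2]
      exact G.connectedComponentMk_eq_of_sameCycle h'
    subst hqr
    congr 1
    exact Quotient.sound ((G.component_sameCycle q i j v w).2 h')
  · intro x
    obtain ⟨w, rfl⟩ := Quotient.exists_rep x
    exact ⟨⟨G.toSimpleGraph.connectedComponentMk (Sum.inl w),
      Quotient.mk (Equiv.Perm.SameCycle.setoid _) ⟨w, rfl⟩⟩, rfl⟩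

-- This is `degree_eq` for `n - 1` colors summed over the bubbles: orders and face numbers are
-- additive over components, while the constant `1` counts bubbles.
open Classical in
theorem sum_degree_bubble [Fintype C] (hC : 4 ≤ Fintype.card C) (G : ColoredGraph C) (i : C) :
    ∑ q, (G.bubble i q).degree = ((Fintype.card C - 2).factorial : ℚ) / 2 *
      (Fintype.card (G.BubbleIndex i) + ((Fintype.card C : ℚ) - 3) / 2 * G.order -
        (∑ c : {c // c ≠ i}, ∑ d ∈ Finset.univ.erase c, (Fintype.card (G.Face c d) : ℚ)) /
          (2 * ((Fintype.card C : ℚ) - 2))) := by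
  have hcard : Fintype.card {c // c ≠ i} = Fintype.card C - 1 := by
    simp [Fintype.card_subtype_compl]
  have hcast : ((Fintype.card C - 1 : ℕ) : ℚ) = Fintype.card C - 1 := by
    rw [Nat.cast_sub (by omega), Nat.cast_one]
  have ho : ∑ q, ((G.bubble i q).order : ℚ) = G.order := by
    exact_mod_cast (G.deleteColor i).sum_order_component
  have hf : ∀ c d : {c // c ≠ i}, ∑ q, (Fintype.card ((G.bubble i q).Face c d) : ℚ) =
      Fintype.card (G.Face c d) := fun c d => by
    exact_mod_cast (G.deleteColor i).sum_card_face_component c d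
  rw [Finset.sum_congr rfl fun q _ => degree_eq (by omega) (G.bubble i q), ← Finset.mul_sum,
    Finset.sum_sub_distrib, Finset.sum_add_distrib, ← Finset.mul_sum, ho, ← Finset.sum_div,
    Finset.sum_comm]
  rw [Finset.sum_congr rfl fun c _ => (Finset.sum_comm.trans
    (Finset.sum_congr rfl fun d _ => hf c d)), hcard, hcast, Finset.sum_const, nsmul_eq_mul, mul_one,
    Finset.card_univ, Nat.sub_sub, show (Fintype.card C : ℚ) - 1 - 2 = Fintype.card C - 3 by ring,
    show (Fintype.card C : ℚ) - 1 - 1 = Fintype.card C - 2 by ring]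
  congr!

-- An ordered pair of distinct colors survives the deletion of `i` for exactly `n - 2` choices of
-- `i`.
open Classical in
theorem sum_sum_erase [Fintype C] (f : C → C → ℚ) :
    ∑ i, ∑ c : {c // c ≠ i}, ∑ d ∈ Finset.univ.erase c, f c.1 d.1 =
      ((Fintype.card C : ℚ) - 2) * ∑ c, ∑ d ∈ Finset.univ.erase c, f c d := by
  have h0 : ∀ (i : C) (g : C → ℚ), ∑ c : {c // c ≠ i}, g c.1 = ∑ c, if c ≠ i then g c else 0 := by
    intro i g
    rw [← Finset.sum_filter]
    exact (Finset.sum_subtype (Finset.univ.filter fun c => c ≠ i) (by simp) g).symm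
  have h1 : ∀ i, ∑ c : {c // c ≠ i}, ∑ d ∈ Finset.univ.erase c, f c.1 d.1 =
      ∑ c, ∑ d ∈ Finset.univ.erase c, if i ≠ c ∧ i ≠ d then f c d else 0 := by
    intro i
    have h2 : ∀ c : {c // c ≠ i}, ∑ d ∈ Finset.univ.erase c, f c.1 d.1 =
        ∑ d, if d ≠ i then if d ≠ c.1 then f c.1 d else 0 else 0 := by
      intro c
      rw [← h0, ← Finset.filter_ne', Finset.sum_filter]
      simp only [ne_eq, Subtype.ext_iff]
    rw [Finset.sum_congr rfl fun c _ => h2 c,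
      h0 i fun c => ∑ d, if d ≠ i then if d ≠ c then f c d else 0 else 0]
    refine Finset.sum_congr rfl fun c _ => ?_
    rw [← Finset.filter_ne', Finset.sum_filter]
    split_ifs with hc
    · refine Finset.sum_congr rfl fun d _ => ?_
      by_cases hd : d = i
      · simp [hd]
      · simp [hd, Ne.symm hd, hc.symm]
    · rw [not_not] at hc
      simp [hc]
  rw [Finset.sum_congr rfl fun i _ => h1 i, Finset.sum_comm, Finset.mul_sum]
  refine Finset.sum_congr rfl fun c _ => ?_
  rw [Finset.sum_comm, Finset.mul_sum]
  refine Finset.sum_congr rfl fun d hd => ?_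
  rw [← Finset.sum_filter, Finset.sum_const, nsmul_eq_mul]
  congr 1
  have : (Finset.univ.filter fun i => i ≠ c ∧ i ≠ d) = ({c, d} : Finset C)ᶜ := by
    ext i; simp
  have hle := Finset.card_le_univ ({c, d} : Finset C)
  rw [Finset.card_pair (Finset.ne_of_mem_erase hd).symm] at hle
  rw [this, Finset.card_compl, Finset.card_pair (Finset.ne_of_mem_erase hd).symm, Nat.cast_sub hle]
  norm_num

end Bubbles

end ColoredGraph

namespace ColoredGraph

/-! ### The number of bubbles of a connected graph -/

section BubbleCount

variable {C : Type u}

/-- The bubble without the color `i` at a vertex. -/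
def bubbleAt (G : ColoredGraph C) (i : C) (v : G.Vertex) : G.BubbleIndex i :=
  (G.deleteColor i).toSimpleGraph.connectedComponentMk v

theorem bubbleAt_line (G : ColoredGraph C) {i c : C} (h : c ≠ i) (w : G.White) :
    G.bubbleAt i (Sum.inr (G.line c w)) = G.bubbleAt i (Sum.inl w) :=
  (G.deleteColor i).reachable_line ⟨c, h⟩ w

theorem bubbleAt_surjective (G : ColoredGraph C) (i : C) :
    Function.Surjective (G.bubbleAt i) := fun q => Quot.exists_rep q

/-- If functions `u i`, constant on the bubbles without the color `i`, add up to zero on the white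
vertices, then each of them is constant along all lines. -/
theorem line_eq_of_sum_eq_zero [Fintype C] (hC : 3 ≤ Fintype.card C) (G : ColoredGraph C)
    (u : C → G.Vertex → ℝ)
    (hu : ∀ i c, c ≠ i → ∀ w, u i (Sum.inr (G.line c w)) = u i (Sum.inl w))
    (h0 : ∀ w, ∑ i, u i (Sum.inl w) = 0) (i c : C) (w : G.White) :
    u i (Sum.inr (G.line c w)) = u i (Sum.inl w) := by
  classical
  -- `h` is the total at a black vertex. Along a line of color `c` only `u c` can change, so its
  -- jump is the jump of the total, namely `h`.
  set h : G.Black → ℝ := fun b => ∑ i, u i (Sum.inr b) with hh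
  have h1 : ∀ c w, u c (Sum.inl w) = u c (Sum.inr (G.line c w)) - h (G.line c w) := by
    intro c w
    have : h (G.line c w) - ∑ i, u i (Sum.inl w) =
        u c (Sum.inr (G.line c w)) - u c (Sum.inl w) := by
      rw [hh, ← Finset.sum_sub_distrib]
      refine Finset.sum_eq_single c (fun j _ hj => ?_) (by simp)
      rw [hu j c hj.symm, sub_self]
    rw [h0] at this
    linarith
  -- The squared norm of `u i` on the white vertices is transported to the black ones in two ways:
  -- along a color `j ≠ i`, where `u i` does not change, and along `i`, where it shifts by `h`.
  have h2 : ∀ i, ∑ b, 2 * (h b * u i (Sum.inr b)) = ∑ b, h b ^ 2 := by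
    intro i
    have : Nontrivial C := Fintype.one_lt_card_iff_nontrivial.1 (by omega)
    obtain ⟨j, hj⟩ := exists_ne i
    have e1 : ∑ w, u i (Sum.inl w) ^ 2 = ∑ b, u i (Sum.inr b) ^ 2 := by
      rw [← Equiv.sum_comp (G.line j)]
      exact Finset.sum_congr rfl fun w _ => by rw [hu i j hj]
    have e2 : ∑ w, u i (Sum.inl w) ^ 2 = ∑ b, (u i (Sum.inr b) - h b) ^ 2 := by
      rw [← Equiv.sum_comp (G.line i)]
      exact Finset.sum_congr rfl fun w _ => by rw [h1 i]
    rw [e1, ← sub_eq_zero, ← Finset.sum_sub_distrib] at e2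
    rw [← sub_eq_zero, ← Finset.sum_sub_distrib, ← e2]
    exact Finset.sum_congr rfl fun b _ => by ring
  -- Summing over `i` gives `2 ∑ h² = n ∑ h²`, which forces `h = 0` because `n ≠ 2`.
  have h3 : ∑ b, h b ^ 2 = 0 := by
    have e := Finset.sum_congr (rfl : (Finset.univ : Finset C) = _) fun i _ => h2 i
    rw [Finset.sum_comm, Finset.sum_const, nsmul_eq_mul, Finset.card_univ] at e
    have e' : ∑ b, ∑ i, 2 * (h b * u i (Sum.inr b)) = 2 * ∑ b, h b ^ 2 := by
      rw [Finset.mul_sum]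
      refine Finset.sum_congr rfl fun b _ => ?_
      rw [← Finset.mul_sum, ← Finset.mul_sum, pow_two]
    rw [e'] at e
    have hn : (3 : ℝ) ≤ Fintype.card C := by exact_mod_cast hC
    have : ((Fintype.card C : ℝ) - 2) * ∑ b, h b ^ 2 = 0 := by linarith
    exact (mul_eq_zero.1 this).resolve_left (by linarith)
  have h4 : ∀ b, h b = 0 := fun b => by
    have := (Finset.sum_eq_zero_iff_of_nonneg fun b _ => sq_nonneg (h b)).1 h3 b (Finset.mem_univ b)
    exact pow_eq_zero_iff two_ne_zero |>.1 this
  rcases eq_or_ne c i with rfl | hne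
  · rw [h1 c w, h4, sub_zero]
  · exact hu i c hne w

/-- A connected graph with `2 p` vertices and `D + 1` colors has at most `p + D` bubbles. -/
theorem sum_card_bubbleIndex_le [Fintype C] (hC : 3 ≤ Fintype.card C) (G : ColoredGraph C)
    (hG : G.IsConnected) :
    ∑ i, Fintype.card (G.BubbleIndex i) + 1 ≤ G.order + Fintype.card C := by
  classical
  obtain ⟨i₀⟩ : Nonempty C := Fintype.card_pos_iff.1 (by omega)
  obtain ⟨w₀⟩ : Nonempty G.White := by
    obtain ⟨v⟩ := hG.nonempty
    rcases v with w | b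
    · exact ⟨w⟩
    · exact ⟨(G.line i₀).symm b⟩
  -- The bound is a dimension count: bubbles index the source, and the target has dimension `p + D`.
  -- The second component removes the constants `f i` with total zero, which form the kernel of the
  -- first when the graph is connected.
  let Φ : (∀ i, G.BubbleIndex i → ℝ) →ₗ[ℝ] (G.White → ℝ) × ({i // i ≠ i₀} → ℝ) :=
    { toFun := fun f => (fun w => ∑ i, f i (G.bubbleAt i (Sum.inl w)),
        fun i => f i.1 (G.bubbleAt i.1 (Sum.inl w₀)))
      map_add' := fun f g => by
        ext <;> simp [Finset.sum_add_distrib]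
      map_smul' := fun r f => by
        ext <;> simp [Finset.mul_sum] }
  have hinj : Function.Injective Φ := by
    rw [← LinearMap.ker_eq_bot, LinearMap.ker_eq_bot']
    intro f hf
    have hf1 : ∀ w, ∑ i, f i (G.bubbleAt i (Sum.inl w)) = 0 := fun w =>
      congrFun (congrArg Prod.fst hf) w
    have hf2 : ∀ i, i ≠ i₀ → f i (G.bubbleAt i (Sum.inl w₀)) = 0 := fun i hi =>
      congrFun (congrArg Prod.snd hf) ⟨i, hi⟩
    have hline := line_eq_of_sum_eq_zero hC G (fun i v => f i (G.bubbleAt i v))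
      (fun i c h w => by rw [G.bubbleAt_line h]) hf1
    have hconst : ∀ i v, f i (G.bubbleAt i v) = f i (G.bubbleAt i (Sum.inl w₀)) := fun i v =>
      G.eq_of_reachable (fun v => f i (G.bubbleAt i v)) (hline i) (hG.preconnected v _)
    have hz : ∀ i, f i (G.bubbleAt i (Sum.inl w₀)) = 0 := by
      intro i
      rcases eq_or_ne i i₀ with rfl | hi
      · rw [← hf1 w₀]
        exact (Finset.sum_eq_single i (fun j _ hj => hf2 j hj) (by simp)).symm
      · exact hf2 i hi
    funext i q
    obtain ⟨v, rfl⟩ := G.bubbleAt_surjective i q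
    rw [hconst, hz]
    rfl
  have h := LinearMap.finrank_le_finrank_of_injective hinj
  rw [Module.finrank_pi_fintype, Module.finrank_prod, Module.finrank_fintype_fun_eq_card,
    Module.finrank_fintype_fun_eq_card] at h
  simp only [Module.finrank_fintype_fun_eq_card] at h
  have hcard : Fintype.card {i // i ≠ i₀} = Fintype.card C - 1 := by
    simp [Fintype.card_subtype_compl]
  rw [hcard] at h
  unfold order
  omega

-- The core condition enters here: a unique bubble of degree `0` makes both sides zero, and
-- otherwise each bubble contributes at least `1` to the right side.
open Classical in
theorem card_bubbleIndex_le_of_core [Fintype C] (G : ColoredGraph C) (hG : G.IsTopologicalCore)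
    (i : C) : (Fintype.card (G.BubbleIndex i) : ℚ) - 1 ≤ ∑ q, (G.bubble i q).degree := by
  rcases hG.2 i with ⟨q, hq, hd⟩ | h
  · have hs : (Finset.univ : Finset (G.BubbleIndex i)) = {q} := by
      ext r; simp [hq r]
    have h0 : ∑ q, (G.bubble i q).degree = 0 := by
      rw [hs, Finset.sum_singleton]
      convert hd
    rw [h0, ← Finset.card_univ, hs]
    simp
  · have h1 : ∑ _q : G.BubbleIndex i, (1 : ℚ) ≤ ∑ q, (G.bubble i q).degree :=
      Finset.sum_le_sum fun q _ => by convert h q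
    rw [Finset.sum_const, nsmul_eq_mul, mul_one, Finset.card_univ] at h1
    linarith

end BubbleCount

end ColoredGraph

/-! ### Face count of topological core graphs -/

namespace ColoredGraph

open Classical in
/-- A topological core graph has few faces. -/
theorem sum_card_face_le_of_core {C : Type u} [Fintype C] (hC : 4 ≤ Fintype.card C)
    (G : ColoredGraph C) (hG : G.IsTopologicalCore) :
    (∑ c, ∑ d ∈ Finset.univ.erase c, (Fintype.card (G.Face c d) : ℚ)) / 2 ≤
      ((Fintype.card C : ℚ) - 1) +
        ((Fintype.card C : ℚ) - 1) * ((Fintype.card C : ℚ) - 2) / 2 * G.order -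
        2 / ((Fintype.card C - 2).factorial : ℚ) * ((G.order : ℚ) - 1) := by
  set n : ℚ := (Fintype.card C : ℚ) with hn
  set a : ℚ := ((Fintype.card C - 2).factorial : ℚ) / 2 with ha
  set S : ℚ := ∑ c, ∑ d ∈ Finset.univ.erase c, (Fintype.card (G.Face c d) : ℚ) with hS
  set B : ℚ := ∑ i, (Fintype.card (G.BubbleIndex i) : ℚ) with hB
  have hn4 : (4 : ℚ) ≤ n := by rw [hn]; exact_mod_cast hC
  have ha1 : 1 ≤ a := by
    have h : Nat.factorial 2 ≤ (Fintype.card C - 2).factorial := Nat.factorial_le (by omega)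
    have h' : (2 : ℚ) ≤ (Fintype.card C - 2).factorial := by exact_mod_cast h
    rw [ha]
    linarith
  have h1 : B + 1 ≤ G.order + n := by
    have := G.sum_card_bubbleIndex_le (by omega) hG.1
    rw [hB, hn]
    exact_mod_cast this
  have h2 : B - n ≤ ∑ i, ∑ q, (G.bubble i q).degree := by
    have h := Finset.sum_le_sum fun i (_ : i ∈ Finset.univ) => G.card_bubbleIndex_le_of_core hG i
    rw [Finset.sum_sub_distrib, Finset.sum_const, nsmul_eq_mul, mul_one, Finset.card_univ] at h
    exact h
  have h3 : ∑ i, ∑ q, (G.bubble i q).degree = a * (B + (n - 3) / 2 * n * G.order - S / 2) := by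
    rw [Finset.sum_congr rfl fun i _ => G.sum_degree_bubble hC i, ← Finset.mul_sum,
      Finset.sum_sub_distrib, Finset.sum_add_distrib, Finset.sum_const, nsmul_eq_mul,
      Finset.card_univ, ← Finset.sum_div, sum_sum_erase fun c d => (Fintype.card (G.Face c d) : ℚ),
      ← hS, ← hn, ← hB, ← ha]
    have : n - 2 ≠ 0 := by linarith
    field_simp
  have h4 : 2 / ((Fintype.card C - 2).factorial : ℚ) = 1 / a := by
    rw [ha, one_div_div]
  rw [h3] at h2
  rw [h4]
  have h5 : (B - n) / a ≤ B + (n - 3) / 2 * n * G.order - S / 2 := by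
    rw [div_le_iff₀ (by linarith)]
    linarith
  -- The slack in `B ≤ p + n - 1` is only diminished by division by `a ≥ 1`; hence the largest `B`
  -- is the worst case.
  have h6 : (G.order + n - 1 - B) / a ≤ G.order + n - 1 - B :=
    div_le_self (by linarith) ha1
  have h7 : 1 / a * ((G.order : ℚ) - 1) = (G.order + n - 1 - B) / a + (B - n) / a := by
    ring
  rw [h7]
  linarith

/-! ### The faces of a jacket and their connectedness -/

section Faces

variable {D : ℕ}

/-- The faces of all pairs of colors. -/
abbrev FaceIndex (G : ColoredGraph (Fin (D + 1))) : Type :=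
  Σ i : Fin (D + 1), Σ j : Fin (D + 1), G.Face i j

/-- All the faces of the graph, each listed once. -/
noncomputable def allFaces (G : ColoredGraph (Fin (D + 1))) : Finset G.FaceIndex :=
  Finset.univ.sigma fun i => (Finset.Ioi i).sigma fun _ => Finset.univ

theorem mem_allFaces {G : ColoredGraph (Fin (D + 1))} {x : G.FaceIndex} :
    x ∈ G.allFaces ↔ x.1 < x.2.1 := by
  simp [allFaces]

open Classical in
/-- The faces of the jacket of the color cycle `τ`. -/
noncomputable def jacketFaces (G : ColoredGraph (Fin (D + 1))) (τ : Equiv.Perm (Fin (D + 1))) :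
    Finset G.FaceIndex :=
  G.allFaces.filter fun x => x.2.1 = τ x.1 ∨ x.1 = τ x.2.1

theorem jacketFaces_subset (G : ColoredGraph (Fin (D + 1))) (τ : Equiv.Perm (Fin (D + 1))) :
    G.jacketFaces τ ⊆ G.allFaces := Finset.filter_subset _ _

open Classical in
theorem card_filter_allFaces (G : ColoredGraph (Fin (D + 1)))
    (R : Fin (D + 1) → Fin (D + 1) → Prop) :
    (G.allFaces.filter fun x => R x.1 x.2.1).card =
      ∑ i, ∑ j, if i < j ∧ R i j then Fintype.card (G.Face i j) else 0 := by
  have : (G.allFaces.filter fun x => R x.1 x.2.1) =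
      Finset.univ.sigma fun i => (Finset.univ.filter fun j => i < j ∧ R i j).sigma
        fun _ => Finset.univ := by
    ext x
    simp [mem_allFaces]
  rw [this, Finset.card_sigma]
  refine Finset.sum_congr rfl fun i _ => ?_
  rw [Finset.card_sigma, Finset.sum_filter]
  rfl

theorem two_mul_card_allFaces (G : ColoredGraph (Fin (D + 1))) :
    2 * G.allFaces.card = ∑ c, ∑ d ∈ Finset.univ.erase c, Fintype.card (G.Face c d) := by
  classical
  have h := G.card_filter_allFaces fun _ _ => True
  simp only [and_true, Finset.filter_true] at h
  have h' : G.allFaces.card = ∑ i, ∑ j, if j < i then Fintype.card (G.Face i j) else 0 := by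
    rw [h, Finset.sum_comm]
    simp only [G.card_face_comm]
  rw [two_mul]
  nth_rewrite 1 [h]
  rw [h', ← Finset.sum_add_distrib]
  refine Finset.sum_congr rfl fun i _ => ?_
  rw [← Finset.sum_add_distrib, ← Finset.filter_ne', Finset.sum_filter]
  refine Finset.sum_congr rfl fun j _ => ?_
  rcases lt_trichotomy i j with hij | hij | hij
  · simp [hij, hij.ne', hij.not_gt]
  · simp [hij]
  · simp [hij, hij.ne, hij.not_gt]

theorem card_jacketFaces (G : ColoredGraph (Fin (D + 1))) {τ : Equiv.Perm (Fin (D + 1))}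
    (hτ : τ ∈ colorCycles (Fin (D + 1))) (hD : 2 ≤ D) :
    (G.jacketFaces τ).card = G.cycleFaceCount τ := by
  classical
  have hC : 3 ≤ Fintype.card (Fin (D + 1)) := by simp; omega
  have h1 : (G.jacketFaces τ).card = ∑ i, ∑ j,
      ((if i < j ∧ j = τ i then Fintype.card (G.Face i j) else 0) +
        if i < j ∧ i = τ j then Fintype.card (G.Face i j) else 0) := by
    refine Eq.trans (by unfold jacketFaces; congr!)
      ((G.card_filter_allFaces fun i j => j = τ i ∨ i = τ j).trans ?_)
    refine Finset.sum_congr rfl fun i _ => Finset.sum_congr rfl fun j _ => ?_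
    by_cases hij : i < j
    · by_cases h : j = τ i
      · have : i ≠ τ j := by
          rw [h]
          exact (colorCycle_apply_apply_ne hτ hC i).symm
        simp [← h, this]
      · simp [h]
    · simp [hij]
  have h2 : ∑ i, ∑ j, (if i < j ∧ i = τ j then Fintype.card (G.Face i j) else 0) =
      ∑ i, ∑ j, if j < i ∧ j = τ i then Fintype.card (G.Face i j) else 0 := by
    rw [Finset.sum_comm]
    refine Finset.sum_congr rfl fun i _ => Finset.sum_congr rfl fun j _ => ?_
    rw [G.card_face_comm]
  simp only [Finset.sum_add_distrib] at h1
  rw [h1, h2, ← Finset.sum_add_distrib, cycleFaceCount]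
  refine Finset.sum_congr rfl fun i _ => ?_
  rw [← Finset.sum_add_distrib, Finset.sum_eq_single (τ i)]
  · rcases lt_or_gt_of_ne (colorCycle_apply_ne hτ (by omega) i) with h | h
    · simp [h, h.not_gt]
    · simp [h, h.not_gt]
  · intro j _ hj
    simp [hj]
  · simp

/-- The line `l` lies on the face `x`. -/
def OnFace (G : ColoredGraph (Fin (D + 1))) (x : G.FaceIndex) (l : G.Line) : Prop :=
  (l.1 = x.1 ∨ l.1 = x.2.1) ∧ Quotient.mk (Equiv.Perm.SameCycle.setoid _) l.2 = x.2.2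

/-- The face of colors `c, d` at the white vertex `w`. -/
noncomputable def faceAt (G : ColoredGraph (Fin (D + 1))) (c d : Fin (D + 1)) (w : G.White) :
    G.FaceIndex :=
  if c < d then ⟨c, d, Quotient.mk (Equiv.Perm.SameCycle.setoid _) w⟩
  else ⟨d, c, Quotient.mk (Equiv.Perm.SameCycle.setoid _) w⟩

theorem faceAt_comm (G : ColoredGraph (Fin (D + 1))) {c d : Fin (D + 1)} (h : c ≠ d)
    (w : G.White) : G.faceAt c d w = G.faceAt d c w := by
  rcases lt_or_gt_of_ne h with h | h <;> simp [faceAt, h, h.not_gt]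

theorem faceAt_mem_jacketFaces (G : ColoredGraph (Fin (D + 1))) {τ : Equiv.Perm (Fin (D + 1))}
    {c : Fin (D + 1)} (h : τ c ≠ c) (w : G.White) : G.faceAt c (τ c) w ∈ G.jacketFaces τ := by
  rw [jacketFaces, Finset.mem_filter, mem_allFaces]
  by_cases hlt : c < τ c
  · rw [faceAt, if_pos hlt]
    exact ⟨hlt, Or.inl rfl⟩
  · rw [faceAt, if_neg hlt]
    exact ⟨lt_of_le_of_ne (not_lt.1 hlt) h, Or.inr rfl⟩

/-- A jacket is a surface: a line of color `c` borders only the faces coming from the two steps of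
`τ` that leave and enter `c`. -/
theorem exists_faceAt_of_mem_jacketFaces (G : ColoredGraph (Fin (D + 1)))
    {τ : Equiv.Perm (Fin (D + 1))} {x : G.FaceIndex} (hx : x ∈ G.jacketFaces τ) {l : G.Line}
    (hl : G.OnFace x l) :
    x = G.faceAt l.1 (τ l.1) l.2 ∨ x = G.faceAt (τ⁻¹ l.1) l.1 l.2 := by
  obtain ⟨i, j, f⟩ := x
  obtain ⟨c, w⟩ := l
  rw [jacketFaces, Finset.mem_filter, mem_allFaces] at hx
  obtain ⟨hij, hx⟩ := hx
  obtain ⟨hc, hf⟩ := hl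
  simp only at hij hx hc hf
  have key : (⟨i, j, f⟩ : G.FaceIndex) = G.faceAt i j w := by
    rw [faceAt, if_pos hij, ← hf]
  rw [key]
  simp only [Equiv.Perm.inv_def]
  rcases hx with rfl | rfl <;> rcases hc with rfl | rfl
  · exact Or.inl rfl
  · right; rw [Equiv.symm_apply_apply]
  · right; rw [Equiv.symm_apply_apply, faceAt_comm _ hij.ne]
  · left; rw [faceAt_comm _ hij.ne]

theorem onFace_faceAt_left (G : ColoredGraph (Fin (D + 1))) (c d : Fin (D + 1)) (w : G.White) :
    G.OnFace (G.faceAt c d w) (c, w) := by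
  unfold faceAt
  split_ifs
  · exact ⟨Or.inl rfl, rfl⟩
  · exact ⟨Or.inr rfl, rfl⟩

theorem onFace_faceAt_right (G : ColoredGraph (Fin (D + 1))) (c d : Fin (D + 1)) (w : G.White) :
    G.OnFace (G.faceAt c d w) (d, w) := by
  unfold faceAt
  split_ifs
  · exact ⟨Or.inr rfl, rfl⟩
  · exact ⟨Or.inl rfl, rfl⟩

theorem faceAt_strandStep (G : ColoredGraph (Fin (D + 1))) (c d : Fin (D + 1)) (w : G.White) :
    G.faceAt c d (G.strandStep c d w) = G.faceAt c d w := by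
  have h1 : Quotient.mk (Equiv.Perm.SameCycle.setoid (G.strandStep c d)) (G.strandStep c d w) =
      Quotient.mk (Equiv.Perm.SameCycle.setoid (G.strandStep c d)) w :=
    Quotient.sound (s := Equiv.Perm.SameCycle.setoid (G.strandStep c d)) ⟨-1, by simp⟩
  have h2 : Quotient.mk (Equiv.Perm.SameCycle.setoid (G.strandStep d c)) (G.strandStep c d w) =
      Quotient.mk (Equiv.Perm.SameCycle.setoid (G.strandStep d c)) w :=
    Quotient.sound (s := Equiv.Perm.SameCycle.setoid (G.strandStep d c))
      ⟨1, by rw [strandStep_symm]; simp⟩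
  unfold faceAt
  rw [h1, h2]

theorem exists_onFace (G : ColoredGraph (Fin (D + 1))) (x : G.FaceIndex) :
    ∃ w, G.OnFace x (x.1, w) := by
  obtain ⟨w, hw⟩ := Quotient.exists_rep x.2.2
  exact ⟨w, Or.inl rfl, hw⟩

theorem jacketFaces_eq_faceAt (G : ColoredGraph (Fin (D + 1)))
    {τ : Equiv.Perm (Fin (D + 1))} {x : G.FaceIndex} (hx : x ∈ G.jacketFaces τ) :
    ∃ c w, x = G.faceAt c (τ c) w := by
  obtain ⟨w, hw⟩ := G.exists_onFace x
  rcases G.exists_faceAt_of_mem_jacketFaces hx hw with h | h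
  · exact ⟨_, _, h⟩
  · exact ⟨τ⁻¹ x.1, w, h.trans (by simp)⟩

/-- The faces of a jacket of a connected graph are connected through the lines: a nonempty proper
subset of them has a line which lies on exactly one of its faces. -/
theorem exists_private_line (G : ColoredGraph (Fin (D + 1))) (hG : G.IsConnected) (hD : 2 ≤ D)
    {τ : Equiv.Perm (Fin (D + 1))} (hτ : τ ∈ colorCycles (Fin (D + 1)))
    {S : Finset G.FaceIndex} (hS : S ⊂ G.jacketFaces τ) (hne : S.Nonempty) :
    ∃ x ∈ S, ∃ l, G.OnFace x l ∧ ∀ y ∈ S, y ≠ x → ¬ G.OnFace y l := by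
  by_contra! hcon
  have hC : 2 ≤ Fintype.card (Fin (D + 1)) := by simp; omega
  set P : Fin (D + 1) → G.White → Prop := fun c w => G.faceAt c (τ c) w ∈ S with hP
  -- The faces `(c, τ c)` and `(τ c, τ (τ c))` at `w` share the line of color `τ c`. With no private
  -- line, one of them is in `S` only together with the other.
  have h1 : ∀ c w, P c w ↔ P (τ c) w := by
    intro c w
    have e : G.faceAt (τ⁻¹ (τ c)) (τ c) w = G.faceAt c (τ c) w := by simp
    constructor
    · intro h
      obtain ⟨y, hy, hyx, hyl⟩ := hcon _ h (τ c, w) (G.onFace_faceAt_right _ _ _)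
      rcases G.exists_faceAt_of_mem_jacketFaces (hS.1 hy) hyl with h' | h'
      · rw [h'] at hy
        exact hy
      · exact absurd (h'.trans e) hyx
    · intro h
      obtain ⟨y, hy, hyx, hyl⟩ := hcon _ h (τ c, w) (G.onFace_faceAt_left _ _ _)
      rcases G.exists_faceAt_of_mem_jacketFaces (hS.1 hy) hyl with h' | h'
      · exact absurd h' hyx
      · rw [h', e] at hy
        exact hy
  have hcyc : ∀ Q : Fin (D + 1) → Prop, (∀ c, Q c ↔ Q (τ c)) → ∀ c d, Q c ↔ Q d := by
    intro Q hQ c d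
    obtain ⟨n, rfl⟩ :=
      ((mem_colorCycles.1 hτ).2 (Set.mem_univ c) (Set.mem_univ d)).exists_nat_pow_eq
    induction n with
    | zero => rfl
    | succ n ih => rw [ih, pow_succ', Equiv.Perm.mul_apply, hQ]
  have h2 : ∀ c d w, P c w ↔ P d w := fun c d w => hcyc (fun c => P c w) (fun c => h1 c w) c d
  -- Membership also passes between the white neighbours of a black vertex: those along `c` and `τ
  -- c` lie on one common face of the jacket.
  have h3 : ∀ c d b, P 0 ((G.line c).symm b) ↔ P 0 ((G.line d).symm b) := by
    intro c d b
    refine hcyc (fun c => P 0 ((G.line c).symm b)) (fun c => ?_) c d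
    have : (G.line (τ c)).symm b = G.strandStep c (τ c) ((G.line c).symm b) := by
      simp [strandStep]
    rw [this, h2 0 c, h2 0 c, hP]
    simp only [faceAt_strandStep]
  have h4 : ∀ v w, P 0 v ↔ P 0 w := by
    intro v w
    refine iff_of_eq (G.eq_of_reachable
      (Sum.elim (P 0) fun b => P 0 ((G.line 0).symm b)) (fun c w => ?_)
      (hG.preconnected (Sum.inl v) (Sum.inl w)))
    simp only [Sum.elim_inr, Sum.elim_inl]
    rw [h3 0 c, Equiv.symm_apply_apply]
  obtain ⟨x, hx⟩ := hne
  obtain ⟨y, hy, hyS⟩ := Finset.exists_of_ssubset hS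
  obtain ⟨c, v, rfl⟩ := G.jacketFaces_eq_faceAt (hS.1 hx)
  obtain ⟨d, w, rfl⟩ := G.jacketFaces_eq_faceAt hy
  exact hyS ((h2 0 d w).1 ((h4 v w).1 ((h2 c 0 v).1 hx)))

end Faces

end ColoredGraph

namespace ColoredGraph

/-! ### Holonomies -/

section Holonomy

variable {C : Type u} {Γ : Type*} [Group Γ]

theorem iterate_strandStep_sameCycle (G : ColoredGraph C) (i j : C) (w : G.White) (k : ℕ) :
    (G.strandStep i j).SameCycle ((G.strandStep i j)^[k] w) w := by
  refine ⟨-k, ?_⟩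
  rw [Equiv.Perm.iterate_eq_pow, zpow_neg, zpow_natCast]
  simp [Equiv.Perm.inv_def]

theorem minimalPeriod_strandStep_pos (G : ColoredGraph C) (i j : C) (w : G.White) :
    0 < Function.minimalPeriod (G.strandStep i j) w := by
  refine Function.minimalPeriod_pos_of_mem_periodicPts
    ⟨orderOf (G.strandStep i j), orderOf_pos _, ?_⟩
  rw [Function.IsPeriodicPt, Function.IsFixedPt, Equiv.Perm.iterate_eq_pow, pow_orderOf_eq_one]
  rfl

theorem holonomy_one (G : ColoredGraph C) (i j : C) (w : G.White) :
    G.holonomy (1 : G.Line → Γ) i j w = 1 := by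
  unfold holonomy
  refine List.prod_eq_one fun x hx => ?_
  obtain ⟨k, -, rfl⟩ := List.mem_map.1 hx
  simp

theorem map_holonomy_mul {A : Type*} [CommGroup A] (f : Γ →* A) (G : ColoredGraph C)
    (h h' : G.Line → Γ) (i j : C) (w : G.White) :
    f (G.holonomy (h * h') i j w) = f (G.holonomy h i j w) * f (G.holonomy h' i j w) := by
  unfold holonomy
  rw [map_list_prod, map_list_prod, map_list_prod, List.map_map, List.map_map, List.map_map,
    ← List.prod_map_mul]
  congr 1
  refine List.map_congr_left fun k _ => ?_
  simp only [Function.comp_apply, Pi.mul_apply, map_mul, map_inv, mul_inv]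
  exact mul_mul_mul_comm _ _ _ _

theorem continuous_holonomy [TopologicalSpace Γ] [IsTopologicalGroup Γ] (G : ColoredGraph C)
    (i j : C) (w : G.White) : Continuous fun h : G.Line → Γ => G.holonomy h i j w := by
  unfold holonomy
  exact continuous_list_prod _ fun k _ => by fun_prop

/-- Class functions do not see the starting point of a holonomy. -/
theorem map_holonomy_eq_of_sameCycle {X : Type*} (φ : Γ → X) (hφ : ∀ g k, φ (k * g * k⁻¹) = φ g)
    (G : ColoredGraph C) (h : G.Line → Γ) {i j : C} {v w : G.White}
    (hvw : (G.strandStep i j).SameCycle v w) :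
    φ (G.holonomy h i j v) = φ (G.holonomy h i j w) := by
  obtain ⟨n, rfl⟩ := hvw.exists_nat_pow_eq
  clear hvw
  induction n with
  | zero => rfl
  | succ n ih =>
    obtain ⟨k, hk⟩ := G.holonomy_strandStep h i j ((G.strandStep i j ^ n) v)
    rw [ih, pow_succ', Equiv.Perm.mul_apply, hk, hφ]

theorem strandStep_iterate_ne (G : ColoredGraph C) {i j : C} {w : G.White} {k : ℕ} (hk : 0 < k)
    (hk' : k < Function.minimalPeriod (G.strandStep i j) w) : (G.strandStep i j)^[k] w ≠ w :=
  Function.not_isPeriodicPt_of_pos_of_lt_minimalPeriod hk.ne' hk'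

/-- Starting at `w`, the strand traverses the line `(i, w)` first and does not return to it within
one period. -/
theorem holonomy_of_mul_left (G : ColoredGraph C) {i j : C} (hij : i ≠ j) (w : G.White) (g : Γ)
    {h h' : G.Line → Γ} (hw : h' (i, w) = g * h (i, w)) (hne : ∀ l, l ≠ (i, w) → h' l = h l) :
    G.holonomy h' i j w = g * G.holonomy h i j w := by
  obtain ⟨m, hm⟩ : ∃ m, Function.minimalPeriod (G.strandStep i j) w = m + 1 :=
    ⟨_, (Nat.sub_add_cancel (G.minimalPeriod_strandStep_pos i j w)).symm⟩
  have h1 : ∀ v, h' (j, v) = h (j, v) := fun v => hne _ fun e => hij (congrArg Prod.fst e).symm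
  have h2 : ∀ v, v ≠ w → h' (i, v) = h (i, v) := fun v hv => hne _ fun e => hv (congrArg Prod.snd e)
  unfold holonomy
  rw [hm, List.prod_range_succ', List.prod_range_succ']
  simp only [h1]
  have e : ((List.range m).map fun k => h' (i, (G.strandStep i j)^[k.succ] w) *
      (h (j, (G.strandStep i j)^[k.succ + 1] w))⁻¹) =
      (List.range m).map fun k => h (i, (G.strandStep i j)^[k.succ] w) *
      (h (j, (G.strandStep i j)^[k.succ + 1] w))⁻¹ :=
    List.map_congr_left fun k hk => by
      rw [List.mem_range] at hk
      rw [h2 _ (G.strandStep_iterate_ne k.succ_pos (by omega))]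
  rw [e, Function.iterate_zero, id, hw]
  simp only [mul_assoc]

/-- The line `(j, w)` closes the strand that starts at `w`: it is traversed last, backwards, whence
the factor `g⁻¹` on the right. -/
theorem holonomy_of_mul_right (G : ColoredGraph C) {i j : C} (hij : i ≠ j) (w : G.White) (g : Γ)
    {h h' : G.Line → Γ} (hw : h' (j, w) = g * h (j, w)) (hne : ∀ l, l ≠ (j, w) → h' l = h l) :
    G.holonomy h' i j w = G.holonomy h i j w * g⁻¹ := by
  obtain ⟨m, hm⟩ : ∃ m, Function.minimalPeriod (G.strandStep i j) w = m + 1 :=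
    ⟨_, (Nat.sub_add_cancel (G.minimalPeriod_strandStep_pos i j w)).symm⟩
  have h1 : ∀ v, h' (i, v) = h (i, v) := fun v => hne _ fun e => hij (congrArg Prod.fst e)
  have h2 : ∀ v, v ≠ w → h' (j, v) = h (j, v) := fun v hv => hne _ fun e => hv (congrArg Prod.snd e)
  have hit : (G.strandStep i j)^[m + 1] w = w := hm ▸ Function.iterate_minimalPeriod
  unfold holonomy
  rw [hm, List.prod_range_succ, List.prod_range_succ]
  simp only [h1]
  have e : ((List.range m).map fun k => h (i, (G.strandStep i j)^[k] w) *
      (h' (j, (G.strandStep i j)^[k + 1] w))⁻¹) =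
      (List.range m).map fun k => h (i, (G.strandStep i j)^[k] w) *
      (h (j, (G.strandStep i j)^[k + 1] w))⁻¹ :=
    List.map_congr_left fun k hk => by
      rw [List.mem_range] at hk
      rw [h2 _ (G.strandStep_iterate_ne k.succ_pos (by omega))]
  rw [e, hit, hw]
  simp only [mul_assoc, mul_inv_rev]

theorem holonomy_congr (G : ColoredGraph C) {i j : C} (v : G.White) {h h' : G.Line → Γ}
    (hh : ∀ l : G.Line, (l.1 = i ∨ l.1 = j) → (G.strandStep i j).SameCycle l.2 v → h' l = h l) :
    G.holonomy h' i j v = G.holonomy h i j v := by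
  have h1 : ∀ c k, (c = i ∨ c = j) →
      h' (c, (G.strandStep i j)^[k] v) = h (c, (G.strandStep i j)^[k] v) := fun c k hc =>
    hh _ hc (G.iterate_strandStep_sameCycle i j v k)
  unfold holonomy
  congr 1
  refine List.map_congr_left fun k _ => ?_
  rw [h1 i k (Or.inl rfl), h1 j (k + 1) (Or.inr rfl)]

end Holonomy

section FaceHolonomy

variable {D : ℕ} {Γ : Type*} [Group Γ]

/-- The holonomy of a face. -/
noncomputable def faceHol (G : ColoredGraph (Fin (D + 1))) (h : G.Line → Γ) (x : G.FaceIndex) : Γ :=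
  G.holonomy h x.1 x.2.1 (Quotient.out x.2.2)

theorem sameCycle_out (G : ColoredGraph (Fin (D + 1))) {x : G.FaceIndex} {w : G.White}
    (h : Quotient.mk (Equiv.Perm.SameCycle.setoid _) w = x.2.2) :
    (G.strandStep x.1 x.2.1).SameCycle (Quotient.out x.2.2) w :=
  Quotient.exact (s := Equiv.Perm.SameCycle.setoid (G.strandStep x.1 x.2.1))
    ((Quotient.out_eq x.2.2).trans h.symm)

theorem faceHol_one (G : ColoredGraph (Fin (D + 1))) (x : G.FaceIndex) :
    G.faceHol (1 : G.Line → Γ) x = 1 := G.holonomy_one _ _ _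

theorem continuous_faceHol [TopologicalSpace Γ] [IsTopologicalGroup Γ]
    (G : ColoredGraph (Fin (D + 1))) (x : G.FaceIndex) :
    Continuous fun h : G.Line → Γ => G.faceHol h x := G.continuous_holonomy _ _ _

open Classical in
theorem faceHol_mulSingle_of_not_onFace (G : ColoredGraph (Fin (D + 1))) {x : G.FaceIndex}
    {l : G.Line} (hl : ¬ G.OnFace x l) (g : Γ) (h : G.Line → Γ) :
    G.faceHol (Pi.mulSingle l g * h) x = G.faceHol h x := by
  refine G.holonomy_congr _ fun m hm hs => ?_
  have hml : m ≠ l := by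
    rintro rfl
    exact hl ⟨hm, (Quotient.sound (s := Equiv.Perm.SameCycle.setoid _) hs).trans
      (Quotient.out_eq x.2.2)⟩
  rw [Pi.mul_apply, Pi.mulSingle_eq_of_ne hml, one_mul]

open Classical in
/-- The dependence of the holonomy of a face on a line of that face, up to conjugation. -/
theorem map_faceHol_mulSingle (G : ColoredGraph (Fin (D + 1))) {x : G.FaceIndex}
    (hx : x ∈ G.allFaces) {l : G.Line} (hl : G.OnFace x l) (h : G.Line → Γ) :
    ∃ k : Γ, (∀ (X : Type) (φ : Γ → X), (∀ g k, φ (k * g * k⁻¹) = φ g) → ∀ g,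
        φ (G.faceHol (Pi.mulSingle l g * h) x) = φ (g * k)) ∨
      ∀ (X : Type) (φ : Γ → X), (∀ g k, φ (k * g * k⁻¹) = φ g) → ∀ g,
        φ (G.faceHol (Pi.mulSingle l g * h) x) = φ (k * g⁻¹) := by
  have hij := (mem_allFaces.1 hx).ne
  have h1 : ∀ g m, m = l → (Pi.mulSingle l g * h : G.Line → Γ) m = g * h m := fun g m hm => by
    rw [hm, Pi.mul_apply, Pi.mulSingle_eq_same]
  have h2 : ∀ g m, m ≠ l → (Pi.mulSingle l g * h : G.Line → Γ) m = h m := fun g m hm => by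
    rw [Pi.mul_apply, Pi.mulSingle_eq_of_ne hm, one_mul]
  -- Class functions allow the face to be read from the white end of `l`, so one `k` serves all of
  -- them.
  refine ⟨G.holonomy h x.1 x.2.1 l.2, hl.1.imp (fun hc X φ hφ g => ?_) fun hc X φ hφ g => ?_⟩
  all_goals rw [faceHol, map_holonomy_eq_of_sameCycle φ hφ G _ (G.sameCycle_out hl.2)]
  · have e : l = (x.1, l.2) := Prod.ext hc rfl
    rw [G.holonomy_of_mul_left hij l.2 g (h1 g _ e.symm) fun m hm => h2 g m fun e' => hm (e'.trans e)]
  · have e : l = (x.2.1, l.2) := Prod.ext hc rfl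
    rw [G.holonomy_of_mul_right hij l.2 g (h1 g _ e.symm) fun m hm => h2 g m fun e' => hm (e'.trans e)]

end FaceHolonomy

end ColoredGraph

namespace ColoredGraph

/-! ### The bound on the integral -/

section Integral

variable {D : ℕ} {Γ : Type*} [Group Γ] [TopologicalSpace Γ]

theorem continuous_coe_circle : Continuous fun z : Circle => (z : ℂ) := continuous_induced_dom

theorem integrable_of_continuous {X E : Type*} [TopologicalSpace X] [CompactSpace X]
    [MeasurableSpace X] [OpensMeasurableSpace X] [NormedAddCommGroup E]
    [SecondCountableTopology E] (ν : Measure X)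
    [IsFiniteMeasureOnCompacts ν] {f : X → E} (hf : Continuous f) : Integrable f ν :=
  hf.integrable_of_hasCompactSupport (HasCompactSupport.of_compactSpace f)

theorem jacketFaces_nonempty (G : ColoredGraph (Fin (D + 1))) (hG : G.IsConnected) (hD : 2 ≤ D)
    {τ : Equiv.Perm (Fin (D + 1))} (hτ : τ ∈ colorCycles (Fin (D + 1))) :
    (G.jacketFaces τ).Nonempty := by
  obtain ⟨v⟩ := hG.nonempty
  have hτ0 : τ 0 ≠ 0 := colorCycle_apply_ne hτ (by simp; omega) 0
  rcases v with w | b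
  · exact ⟨_, G.faceAt_mem_jacketFaces hτ0 w⟩
  · exact ⟨_, G.faceAt_mem_jacketFaces hτ0 ((G.line 0).symm b)⟩

open Classical in
/-- A labelling of the faces by characters defines a character on the lines. -/
noncomputable def faceCharacter (G : ColoredGraph (Fin (D + 1)))
    (κ : {x // x ∈ G.allFaces} → (Γ →ₜ* Circle)) (h : G.Line → Γ) : Circle :=
  ∏ x, κ x (G.faceHol h x.1)

theorem continuous_faceCharacter [IsTopologicalGroup Γ] (G : ColoredGraph (Fin (D + 1)))
    (κ : {x // x ∈ G.allFaces} → (Γ →ₜ* Circle)) : Continuous (G.faceCharacter κ) :=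
  continuous_finsetProd _ fun x _ => (map_continuous (κ x)).comp (G.continuous_faceHol x.1)

theorem faceCharacter_mul (G : ColoredGraph (Fin (D + 1)))
    (κ : {x // x ∈ G.allFaces} → (Γ →ₜ* Circle)) (h h' : G.Line → Γ) :
    G.faceCharacter κ (h * h') = G.faceCharacter κ h * G.faceCharacter κ h' := by
  unfold faceCharacter
  rw [← Finset.prod_mul_distrib]
  exact Finset.prod_congr rfl fun x _ => map_holonomy_mul (κ x : Γ →* Circle) G h h' _ _ _

open Classical in
/-- Two labellings of the faces with trivial characters which agree outside of a jacket and on one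
face of the jacket are equal. -/
theorem eq_of_faceCharacter_eq_one (G : ColoredGraph (Fin (D + 1))) (hG : G.IsConnected)
    (hD : 2 ≤ D) {τ : Equiv.Perm (Fin (D + 1))} (hτ : τ ∈ colorCycles (Fin (D + 1)))
    {κ κ' : {x // x ∈ G.allFaces} → (Γ →ₜ* Circle)} (h1 : ∀ h, G.faceCharacter κ h = 1)
    (h1' : ∀ h, G.faceCharacter κ' h = 1) {r : G.FaceIndex} (hr : r ∈ G.jacketFaces τ)
    (heq : ∀ x : {x // x ∈ G.allFaces}, x.1 = r ∨ x.1 ∉ G.jacketFaces τ → κ x = κ' x) : κ = κ' := by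
  by_contra hcon
  set S : Finset G.FaceIndex := (Finset.univ.filter fun x => κ x ≠ κ' x).map
    (Function.Embedding.subtype _) with hSdef
  have hmem : ∀ x : {x // x ∈ G.allFaces}, x.1 ∈ S ↔ κ x ≠ κ' x := fun x => by
    simp [hSdef]
  have hmem' : ∀ x ∈ S, x ∈ G.allFaces := fun x hx => by
    obtain ⟨y, -, rfl⟩ := Finset.mem_map.1 hx
    exact y.2
  have hsub : S ⊂ G.jacketFaces τ := by
    refine Finset.ssubset_iff_subset_ne.2 ⟨fun x hx => ?_, fun e => ?_⟩
    · by_contra hxj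
      exact (hmem ⟨x, hmem' x hx⟩).1 hx (heq _ (Or.inr hxj))
    · have hr' : r ∈ S := e ▸ hr
      exact (hmem ⟨r, hmem' r hr'⟩).1 hr' (heq _ (Or.inl rfl))
  have hne : S.Nonempty := by
    obtain ⟨x, hx⟩ := Function.ne_iff.1 hcon
    exact ⟨x.1, (hmem x).2 hx⟩
  obtain ⟨x, hx, l, hl, hpriv⟩ := G.exists_private_line hG hD hτ hsub hne
  refine (hmem ⟨x, hmem' x hx⟩).1 hx ?_
  -- Evaluate both labellings on the configuration that is `g` on the private line `l` and trivial
  -- elsewhere: only the face `x` distinguishes them.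
  ext1 g
  have h2 : ∏ y, (κ y (G.faceHol (Pi.mulSingle l g * 1) y.1) /
      κ' y (G.faceHol (Pi.mulSingle l g * 1) y.1)) = 1 := by
    rw [Finset.prod_div_distrib]
    exact div_eq_one.2 ((h1 _).trans (h1' _).symm)
  rw [Finset.prod_eq_single ⟨x, hmem' x hx⟩ (fun y _ hy => ?_) (by simp), div_eq_one] at h2
  · have hclass : ∀ (χ : Γ →ₜ* Circle) (g k : Γ), χ (k * g * k⁻¹) = χ g := fun χ g k => by
      rw [map_mul, map_mul, map_inv, mul_comm, inv_mul_cancel_left]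
    have hone : ∀ χ : Γ →ₜ* Circle, χ (G.faceHol (Pi.mulSingle l 1 * 1) x) = 1 := fun χ => by
      rw [Pi.mulSingle_one, one_mul, faceHol_one, map_one]
    obtain ⟨k, hk | hk⟩ := G.map_faceHol_mulSingle (hmem' x hx) hl (1 : G.Line → Γ)
    · have hk1 : ∀ χ : Γ →ₜ* Circle, χ k = 1 := fun χ => by
        rw [← hone χ, hk Circle χ (hclass χ), one_mul]
      rw [hk Circle _ (hclass _), hk Circle _ (hclass _), map_mul, map_mul, hk1, hk1, mul_one,
        mul_one] at h2
      exact h2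
    · have hk1 : ∀ χ : Γ →ₜ* Circle, χ k = 1 := fun χ => by
        rw [← hone χ, hk Circle χ (hclass χ), inv_one, mul_one]
      rw [hk Circle _ (hclass _), hk Circle _ (hclass _), map_mul, map_mul, hk1, hk1, one_mul,
        one_mul, map_inv, map_inv, inv_inj] at h2
      exact h2
  · rw [div_eq_one]
    by_cases hyS : y.1 ∈ S
    · rw [G.faceHol_mulSingle_of_not_onFace (hpriv y hyS fun e => hy (Subtype.ext e)), faceHol_one,
        map_one, map_one]
    · rw [hmem, not_not] at hyS
      rw [hyS]

variable [IsTopologicalGroup Γ] [CompactSpace Γ] [MeasurableSpace Γ] [BorelSpace Γ]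

-- Orthogonality: translating by `h₀` multiplies the integral by the value of the character at `h₀`,
-- so a nontrivial character integrates to zero.
open Classical in
theorem integral_faceCharacter (μ : Measure Γ) [μ.IsHaarMeasure] [IsProbabilityMeasure μ]
    (G : ColoredGraph (Fin (D + 1))) (κ : {x // x ∈ G.allFaces} → (Γ →ₜ* Circle)) :
    ∫ h : G.Line → Γ, (G.faceCharacter κ h : ℂ) ∂(Measure.pi fun _ => μ) =
      if ∀ h, G.faceCharacter κ h = 1 then 1 else 0 := by
  split_ifs with h1
  · simp [h1]
  · push Not at h1
    obtain ⟨h₀, h₁⟩ := h1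
    have h2 := integral_mul_left_eq_self (μ := Measure.pi fun _ : G.Line => μ)
      (fun h => (G.faceCharacter κ h : ℂ)) h₀
    simp only [faceCharacter_mul, Circle.coe_mul] at h2
    rw [integral_const_mul] at h2
    have h3 : (G.faceCharacter κ h₀ : ℂ) ≠ 1 := fun e => h₁ (Circle.ext e)
    by_contra h4
    exact h3 (mul_right_cancel₀ h4 (h2.trans (one_mul _).symm))

variable [SecondCountableTopology Γ]

/-- Averaging over the translations of one coordinate does not change an integral. -/
theorem integral_pi_eq_integral_translate {L : Type*} [Fintype L] [DecidableEq L] (μ : Measure Γ)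
    [μ.IsHaarMeasure] [IsProbabilityMeasure μ] (l : L) {F : (L → Γ) → ℝ} (hF : Continuous F) :
    ∫ h, F h ∂(Measure.pi fun _ => μ) =
      ∫ h, ∫ g, F (Pi.mulSingle l g * h) ∂μ ∂(Measure.pi fun _ => μ) := by
  have h1 : ∀ g : Γ, ∫ h, F (Pi.mulSingle l g * h) ∂(Measure.pi fun _ => μ) =
      ∫ h, F h ∂(Measure.pi fun _ => μ) := fun g =>
    integral_mul_left_eq_self F (Pi.mulSingle l g)
  have h2 : Continuous (Function.uncurry fun (h : L → Γ) (g : Γ) => F (Pi.mulSingle l g * h)) := by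
    refine hF.comp (Continuous.mul ?_ continuous_fst)
    exact (continuous_mulSingle l).comp continuous_snd
  rw [integral_integral_swap (integrable_of_continuous _ h2)]
  simp [h1]

open Classical in
theorem integral_prod_eq_one (μ : Measure Γ) [μ.IsHaarMeasure] [IsProbabilityMeasure μ] {δ : Γ → ℝ}
    (hcont : Continuous δ) (hconj : ∀ g k, δ (k * g * k⁻¹) = δ g) (hinv : ∀ g, δ g⁻¹ = δ g)
    (hint : ∫ g, δ g ∂μ = 1) (G : ColoredGraph (Fin (D + 1))) (hG : G.IsConnected) (hD : 2 ≤ D)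
    {τ : Equiv.Perm (Fin (D + 1))} (hτ : τ ∈ colorCycles (Fin (D + 1)))
    (S : Finset G.FaceIndex) (hS : S ⊂ G.jacketFaces τ) :
    ∫ h : G.Line → Γ, ∏ x ∈ S, δ (G.faceHol h x) ∂(Measure.pi fun _ => μ) = 1 := by
  induction S using Finset.strongInduction with
  | H S ih =>
    rcases S.eq_empty_or_nonempty with rfl | hne
    · simp
    obtain ⟨x, hx, l, hl, hpriv⟩ := G.exists_private_line hG hD hτ hS hne
    have hcont' : ∀ T : Finset G.FaceIndex,
        Continuous fun h : G.Line → Γ => ∏ x ∈ T, δ (G.faceHol h x) := fun T =>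
      continuous_finsetProd _ fun x _ => hcont.comp (G.continuous_faceHol x)
    rw [integral_pi_eq_integral_translate μ l (hcont' S),
      ← ih (S.erase x) (Finset.erase_ssubset hx) ((Finset.erase_subset _ _).trans_ssubset hS)]
    refine integral_congr_ae (Eventually.of_forall fun h => ?_)
    have h1 : ∀ g, ∏ y ∈ S, δ (G.faceHol (Pi.mulSingle l g * h) y) =
        δ (G.faceHol (Pi.mulSingle l g * h) x) * ∏ y ∈ S.erase x, δ (G.faceHol h y) := fun g => by
      rw [← Finset.mul_prod_erase S _ hx]
      congr 1
      refine Finset.prod_congr rfl fun y hy => ?_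
      rw [G.faceHol_mulSingle_of_not_onFace
        (hpriv y (Finset.mem_of_mem_erase hy) (Finset.ne_of_mem_erase hy))]
    have hswap : ∀ a b, δ (a * b) = δ (b * a) := fun a b => by
      rw [← hconj (a * b) b]
      congr 1
      group
    -- Up to conjugation the holonomy of `x` is a translate of `g` or of `g⁻¹`; Haar invariance and
    -- the symmetry of `δ` reduce this to the normalization.
    have h2 : ∫ g, δ (G.faceHol (Pi.mulSingle l g * h) x) ∂μ = 1 := by
      have hxall : x ∈ G.allFaces := (Finset.mem_filter.1 (hS.1 hx)).1
      obtain ⟨k, hk | hk⟩ := G.map_faceHol_mulSingle hxall hl h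
      · simp only [hk ℝ δ hconj, fun g => hswap g k]
        rw [integral_mul_left_eq_self δ k, hint]
      · have : ∀ g, δ (k * g⁻¹) = δ (k⁻¹ * g) := fun g => by
          rw [← hinv, mul_inv_rev, inv_inv, hswap]
        simp only [hk ℝ δ hconj, this]
        rw [integral_mul_left_eq_self δ k⁻¹, hint]
    simp only [h1]
    rw [integral_mul_const, h2, one_mul]

open Classical in
/-- The bound for nonnegative regularized delta functions with maximum at the unit. -/
theorem integral_le_of_nonneg (μ : Measure Γ) [μ.IsHaarMeasure] [IsProbabilityMeasure μ] {δ : Γ → ℝ}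
    (hcont : Continuous δ) (hconj : ∀ g k, δ (k * g * k⁻¹) = δ g) (hinv : ∀ g, δ g⁻¹ = δ g)
    (hint : ∫ g, δ g ∂μ = 1) (hle : ∀ g, 0 ≤ δ g ∧ δ g ≤ δ 1)
    (G : ColoredGraph (Fin (D + 1))) (hG : G.IsConnected) (hD : 2 ≤ D)
    {τ : Equiv.Perm (Fin (D + 1))} (hτ : τ ∈ colorCycles (Fin (D + 1))) :
    ∫ h : G.Line → Γ, ∏ x ∈ G.allFaces, δ (G.faceHol h x) ∂(Measure.pi fun _ => μ) ≤
      δ 1 ^ ((G.allFaces \ G.jacketFaces τ).card + 1) := by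
  obtain ⟨r, hr⟩ := G.jacketFaces_nonempty hG hD hτ
  have hsub : G.jacketFaces τ ⊆ G.allFaces := G.jacketFaces_subset τ
  have hcont' : ∀ T : Finset G.FaceIndex,
      Continuous fun h : G.Line → Γ => ∏ x ∈ T, δ (G.faceHol h x) := fun T =>
    continuous_finsetProd _ fun x _ => hcont.comp (G.continuous_faceHol x)
  have h1 := integral_prod_eq_one μ hcont hconj hinv hint G hG hD hτ ((G.jacketFaces τ).erase r)
    (Finset.erase_ssubset hr)
  -- The factors off the jacket and the one at `r` are replaced by their maximum, leaving a proper
  -- subset of the jacket faces, whose integral is `1`.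
  have h2 : ∀ h : G.Line → Γ, ∏ x ∈ G.allFaces, δ (G.faceHol h x) ≤
      δ 1 ^ ((G.allFaces \ G.jacketFaces τ).card + 1) *
        ∏ x ∈ (G.jacketFaces τ).erase r, δ (G.faceHol h x) := by
    intro h
    rw [← Finset.prod_sdiff hsub, ← Finset.mul_prod_erase _ _ hr, ← mul_assoc, pow_succ]
    refine mul_le_mul_of_nonneg_right ?_ (Finset.prod_nonneg fun x _ => (hle _).1)
    refine mul_le_mul ?_ (hle _).2 (hle _).1 (pow_nonneg (hle 1).1 _)
    rw [← Finset.prod_const]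
    exact Finset.prod_le_prod (fun x _ => (hle _).1) fun x _ => (hle _).2
  refine (integral_mono (integrable_of_continuous _ (hcont' _))
    (integrable_of_continuous _ ((hcont' _).const_mul _)) h2).trans ?_
  rw [integral_const_mul, h1, mul_one]

open Classical in
/-- The bound for a sharp cutoff on the Fourier modes. -/
theorem integral_le_of_characters (μ : Measure Γ) [μ.IsHaarMeasure] [IsProbabilityMeasure μ]
    {δ : Γ → ℝ} (Λ : Finset (Γ →ₜ* Circle)) (hδ : ∀ g, (δ g : ℂ) = ∑ χ ∈ Λ, (χ g : ℂ))
    (G : ColoredGraph (Fin (D + 1))) (hG : G.IsConnected) (hD : 2 ≤ D)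
    {τ : Equiv.Perm (Fin (D + 1))} (hτ : τ ∈ colorCycles (Fin (D + 1))) :
    ∫ h : G.Line → Γ, ∏ x ∈ G.allFaces, δ (G.faceHol h x) ∂(Measure.pi fun _ => μ) ≤
      δ 1 ^ ((G.allFaces \ G.jacketFaces τ).card + 1) := by
  obtain ⟨r, hr⟩ := G.jacketFaces_nonempty hG hD hτ
  have hsub : G.jacketFaces τ ⊆ G.allFaces := G.jacketFaces_subset τ
  set K := (Fintype.piFinset fun _ : {x // x ∈ G.allFaces} => Λ).filter
    fun κ => ∀ h, G.faceCharacter κ h = 1 with hK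
  -- Expanding the product of character sums turns the integral into the number of labellings whose
  -- total character is trivial.
  have h1 : ∫ h : G.Line → Γ, ∏ x ∈ G.allFaces, δ (G.faceHol h x) ∂(Measure.pi fun _ => μ) =
      (K.card : ℝ) := by
    rw [← Complex.ofReal_inj, ← integral_complex_ofReal]
    have : ∀ h : G.Line → Γ, ((∏ x ∈ G.allFaces, δ (G.faceHol h x) : ℝ) : ℂ) =
        ∑ κ ∈ Fintype.piFinset fun _ : {x // x ∈ G.allFaces} => Λ, (G.faceCharacter κ h : ℂ) := by
      intro h
      rw [← Finset.prod_coe_sort, Complex.ofReal_prod]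
      simp only [hδ]
      rw [Finset.prod_univ_sum]
      refine Finset.sum_congr rfl fun κ _ => ?_
      exact (map_prod Circle.coeHom _ _).symm
    simp only [this]
    have hi : ∀ κ, Integrable (fun h : G.Line → Γ => (G.faceCharacter κ h : ℂ))
        (Measure.pi fun _ => μ) := fun κ => integrable_of_continuous _
      (continuous_coe_circle.comp (G.continuous_faceCharacter κ))
    rw [integral_finsetSum _ fun κ _ => hi κ]
    simp only [integral_faceCharacter]
    rw [← Finset.sum_filter, Finset.sum_const, nsmul_eq_mul, mul_one, Complex.ofReal_natCast]
  have hδ1 : δ 1 = (Λ.card : ℝ) := by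
    have := hδ 1
    simp only [map_one, Circle.coe_one, Finset.sum_const, nsmul_eq_mul, mul_one] at this
    exact_mod_cast this
  set T : Finset G.FaceIndex := insert r (G.allFaces \ G.jacketFaces τ) with hT
  have hTsub : ∀ x ∈ T, x ∈ G.allFaces := fun x hx => by
    rcases Finset.mem_insert.1 hx with rfl | hx
    · exact hsub hr
    · exact (Finset.mem_sdiff.1 hx).1
  have hTcard : T.card = (G.allFaces \ G.jacketFaces τ).card + 1 :=
    Finset.card_insert_of_notMem fun h => (Finset.mem_sdiff.1 h).2 hr
  -- Restriction to `T` is injective on `K`, and `δ 1` is the number of characters in `Λ`.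
  have h2 : K.card ≤ (Fintype.piFinset fun _ : {x // x ∈ T} => Λ).card := by
    refine Finset.card_le_card_of_injOn
      (fun κ x => κ ⟨x.1, hTsub x.1 x.2⟩) (fun κ hκ => ?_) fun κ hκ κ' hκ' he => ?_
    · rw [Finset.mem_coe, Fintype.mem_piFinset]
      intro x
      exact Fintype.mem_piFinset.1 (Finset.mem_filter.1 hκ).1 _
    · refine G.eq_of_faceCharacter_eq_one hG hD hτ (Finset.mem_filter.1 hκ).2
        (Finset.mem_filter.1 hκ').2 hr fun x hx => ?_
      have hxT : x.1 ∈ T := by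
        rw [hT, Finset.mem_insert, Finset.mem_sdiff]
        exact hx.imp_right fun h => ⟨x.2, h⟩
      exact congrFun he ⟨x.1, hxT⟩
  rw [Fintype.card_piFinset, Finset.prod_const, Finset.card_univ, Fintype.card_coe, hTcard] at h2
  rw [h1, hδ1]
  exact_mod_cast h2

end Integral

end ColoredGraph

namespace ColoredGraph

/-! ### Power counting and the final estimate -/

section Amplitude

variable {D : ℕ}

theorem prod_faceWeight {Γ : Type*} [Group Γ] (G : ColoredGraph (Fin (D + 1))) (δ : Γ → ℝ)
    (h : G.Line → Γ) :
    ∏ i : Fin (D + 1), ∏ j ∈ Finset.Ioi i, ∏ f : G.Face i j, G.faceWeight δ h i j f =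
      ∏ x ∈ G.allFaces, δ (G.faceHol h x) := by
  unfold allFaces
  rw [Finset.prod_sigma]
  refine Finset.prod_congr rfl fun i _ => ?_
  rw [Finset.prod_sigma]
  rfl

/-- For some jacket of a topological core graph the power counting of the remaining faces is as
good as claimed. -/
theorem exists_jacket_card_sdiff_le (hD : 2 ≤ D) (G : ColoredGraph (Fin (D + 1)))
    (hG : G.IsTopologicalCore) :
    ∃ τ ∈ colorCycles (Fin (D + 1)),
      (((G.allFaces.card - (G.jacketFaces τ).card : ℕ) : ℚ) + 1) -
        G.order * (((D : ℚ) - 2) * ((D : ℚ) - 1) / 2) ≤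
      (D : ℚ) - 1 - 2 * ((D : ℚ) - 2) / (D.factorial : ℚ) * ((G.order : ℚ) - 1) := by
  classical
  obtain ⟨τ, hτ, h⟩ := G.exists_colorCycle (by simp; omega)
  refine ⟨τ, hτ, ?_⟩
  -- Stated for every decidability instance, since both the classical one and the one of `Fin`
  -- occur.
  have hS : ∀ inst : DecidableEq (Fin (D + 1)), (∑ c, ∑ d ∈ Finset.univ.erase c,
      (Fintype.card (G.Face c d) : ℚ)) = 2 * G.allFaces.card := by
    intro inst
    rw [Subsingleton.elim inst (instDecidableEqFin _)]
    exact_mod_cast G.two_mul_card_allFaces.symm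
  have hsub : (G.jacketFaces τ).card ≤ G.allFaces.card :=
    Finset.card_le_card (G.jacketFaces_subset τ)
  have hD0 : (2 : ℚ) ≤ D := by exact_mod_cast hD
  rw [← G.card_jacketFaces hτ hD, hS, Fintype.card_fin] at h
  rw [Nat.cast_sub hsub]
  set F : ℚ := (G.allFaces.card : ℚ)
  set J : ℚ := ((G.jacketFaces τ).card : ℚ)
  push_cast at h
  -- The chosen jacket has at least the average number `2F/D` of faces.
  have hJ : F - J ≤ ((D : ℚ) - 2) / D * F := by
    rw [div_mul_eq_mul_div, le_div_iff₀ (by linarith)]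
    linarith
  -- For `D = 2` bubbles have only two colors and `degree_eq` does not apply to them; but then `hJ`
  -- gives `F - J ≤ 0`, which suffices.
  rcases hD.eq_or_lt with rfl | hD3
  · norm_num at hJ ⊢
    linarith
  have hF := G.sum_card_face_le_of_core (by simp; omega) (by convert hG)
  rw [hS, Fintype.card_fin] at hF
  have hfac : (D.factorial : ℚ) = D * ((D - 1).factorial : ℚ) := by
    exact_mod_cast (Nat.mul_factorial_pred (by omega)).symm
  rw [show D + 1 - 2 = D - 1 by omega] at hF
  push_cast at hF
  have hpos : (0 : ℚ) < (D - 1).factorial := by exact_mod_cast Nat.factorial_pos _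
  have hF' : F ≤ D + (D : ℚ) * (D - 1) / 2 * G.order -
      2 / ((D - 1).factorial : ℚ) * ((G.order : ℚ) - 1) := by
    have e1 : (D : ℚ) + 1 - 1 = D := by ring
    have e2 : (D : ℚ) + 1 - 2 = D - 1 := by ring
    rw [e1, e2] at hF
    linarith
  have h1 : ((D : ℚ) - 2) / D * F ≤ ((D : ℚ) - 2) / D * (D + (D : ℚ) * (D - 1) / 2 * G.order -
      2 / ((D - 1).factorial : ℚ) * ((G.order : ℚ) - 1)) :=
    mul_le_mul_of_nonneg_left hF' (div_nonneg (by linarith) (by linarith))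
  have h2 : ((D : ℚ) - 2) / D * (D + (D : ℚ) * (D - 1) / 2 * G.order -
      2 / ((D - 1).factorial : ℚ) * ((G.order : ℚ) - 1)) = (D - 2) +
        G.order * (((D : ℚ) - 2) * ((D : ℚ) - 1) / 2) -
        2 * ((D : ℚ) - 2) / (D.factorial : ℚ) * ((G.order : ℚ) - 1) := by
    rw [hfac]
    have : (D : ℚ) ≠ 0 := by linarith
    field_simp
  linarith

end Amplitude

end ColoredGraph

namespace IsRegularizedDelta

variable {Γ : Type*} [Group Γ] [TopologicalSpace Γ] [MeasurableSpace Γ] {μ : Measure Γ}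
  {δ : ℕ → Γ → ℝ}

theorem le_apply_one (h : IsRegularizedDelta μ δ) (N : ℕ) (g : Γ) : δ N g ≤ δ N 1 := by
  rcases h.cutoff N with hle | ⟨Λ, hΛ⟩
  · exact (hle g).2
  · have h1 := hΛ 1
    simp only [map_one, Circle.coe_one, Finset.sum_const, nsmul_eq_mul, mul_one] at h1
    have h2 : δ N 1 = (Λ.card : ℝ) := by exact_mod_cast h1
    rw [h2]
    refine (le_abs_self _).trans ?_
    rw [← Real.norm_eq_abs, ← Complex.norm_real, hΛ]
    refine (norm_sum_le _ _).trans
      ((Finset.sum_congr rfl fun χ _ => Circle.norm_coe (χ g)).le.trans ?_)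
    simp

theorem one_le_apply_one [OpensMeasurableSpace Γ] [CompactSpace Γ] [IsProbabilityMeasure μ]
    (h : IsRegularizedDelta μ δ) (N : ℕ) : 1 ≤ δ N 1 := by
  rw [← h.integral_eq_one N]
  refine (integral_mono (ColoredGraph.integrable_of_continuous μ (h.continuous N))
    (integrable_const (δ N 1)) (h.le_apply_one N)).trans ?_
  simp

end IsRegularizedDelta

/-- The amplitude of a topological core graph with `2 p` vertices is bounded by
`(λ λ̄)^p δ(e)^(D - 1 - 2 (D - 2) (p - 1) / D!)`. -/
theorem mainTheorem3 {Γ : Type*} [Group Γ] [TopologicalSpace Γ] [IsTopologicalGroup Γ]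
    [CompactSpace Γ] [T2Space Γ] [SecondCountableTopology Γ] [MeasurableSpace Γ] [BorelSpace Γ]
    (μ : Measure Γ) [μ.IsHaarMeasure] [IsProbabilityMeasure μ]
    (δ : ℕ → Γ → ℝ) (hδ : IsRegularizedDelta μ δ) (lam : ℂ)
    (D : ℕ) (hD : 2 ≤ D) (p : ℕ) (G : ColoredGraph (Fin (D + 1)))
    (hG : G.IsTopologicalCore) (hp : Fintype.card G.Vertex = 2 * p) (N : ℕ) :
    G.amplitudeBO μ (δ N) lam ≤
      Complex.normSq lam ^ p *
        δ N 1 ^ ((D : ℝ) - 1 - 2 * ((D : ℝ) - 2) / (D.factorial : ℝ) * ((p : ℝ) - 1)) := by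
  classical
  have hpo : G.order = p := by
    have := G.card_vertex
    omega
  -- Powers of `δ N 1` increase with the exponent, so comparing exponents is enough.
  have hx : 1 ≤ δ N 1 := hδ.one_le_apply_one N
  have hx0 : 0 < δ N 1 := one_pos.trans_le hx
  obtain ⟨τ, hτ, hexp⟩ := G.exists_jacket_card_sdiff_le hD hG
  have hint : ∫ h : G.Line → Γ, ∏ x ∈ G.allFaces, δ N (G.faceHol h x) ∂(Measure.pi fun _ => μ) ≤
      δ N 1 ^ ((G.allFaces \ G.jacketFaces τ).card + 1) := by
    rcases hδ.cutoff N with hle | ⟨Λ, hΛ⟩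
    · exact ColoredGraph.integral_le_of_nonneg μ (hδ.continuous N) (hδ.conj N) (hδ.inv N)
        (hδ.integral_eq_one N) hle G hG.1 hD hτ
    · exact ColoredGraph.integral_le_of_characters μ Λ hΛ G hG.1 hD hτ
  rw [Finset.card_sdiff_of_subset (G.jacketFaces_subset τ)] at hint
  have hexp' : (((G.allFaces.card - (G.jacketFaces τ).card + 1 : ℕ) : ℝ)) -
        (p : ℝ) * (((D : ℝ) - 2) * ((D : ℝ) - 1) / 2) ≤
      (D : ℝ) - 1 - 2 * ((D : ℝ) - 2) / (D.factorial : ℝ) * ((p : ℝ) - 1) := by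
    rw [hpo] at hexp
    have h := (Rat.cast_le (K := ℝ)).2 hexp
    push_cast at h ⊢
    exact h
  unfold ColoredGraph.amplitudeBO
  simp only [G.prod_faceWeight]
  rw [hpo, div_mul_eq_mul_div, mul_div_assoc]
  refine mul_le_mul_of_nonneg_left ?_ (pow_nonneg (Complex.normSq_nonneg _) _)
  calc _ ≤ δ N 1 ^ (G.allFaces.card - (G.jacketFaces τ).card + 1) /
        δ N 1 ^ ((p : ℝ) * (((D : ℝ) - 2) * ((D : ℝ) - 1) / 2)) :=
        div_le_div_of_nonneg_right hint (Real.rpow_nonneg hx0.le _)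
    _ = δ N 1 ^ (((G.allFaces.card - (G.jacketFaces τ).card + 1 : ℕ) : ℝ) -
        (p : ℝ) * (((D : ℝ) - 2) * ((D : ℝ) - 1) / 2)) := by
        rw [Real.rpow_sub hx0, Real.rpow_natCast]
    _ ≤ _ := Real.rpow_le_rpow_of_exponent_le hx hexp'
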